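/- Let $K$ be a field and $S=K[x_1,\dots,x_n]$, graded with $\deg x_i=1$. For a finitely generated $\mathbb Z$-graded $S$-module $M$ with minimal graded free resolution $0\leftarrow M\leftarrow F_0\leftarrow F_1\leftarrow\cdots$, $F_i=\bigoplus_j S(-j)^{\beta_{i,j}(M)}$, write $\beta(M)=(\beta_{i,j}(M))_{i,j}$ for its Betti table, regarded as a vector with rational entries. The Boij–Söderberg cone of $S$ is the rational convex cone generated by the Betti tables of all finitely generated graded $S$-modules. For a sequence of integers $d=(d_0,\dots,d_r)$, the module $M$ is called pure of type $d$ if it is Cohen–Macaulay of codimension $r$, that is, $F_i=0$ for $i>r$ and $\dim M=n-r$ (in particular $M\ne 0$), and $\beta_{i,j}(M)=0$ whenever $0\le i\le r$ and $j\neq d_i$. **Proposition 2.1.** Let $M$ be a pure $S$-module of type $d=(d_0,\dots,d_r)$. Then: 1. $d_0<d_1<\dots<d_r$, and the Herzog–Kühl equations hold: $$\sum_{i=0}^r(-1)^i\beta_{i,d_i}(M)\,d_i^{\,s}=0\qquad\text{for } s=0,\dots,r-1.$$ 2. $\beta(M)$ is determined by $d$ up to a positive rational factor: there is a rational number $q>0$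 with $$\beta_{i,d_i}(M)=q\prod_{j\ne i}\frac1{|d_j-d_i|}\qquad\text{for } i=0,\dots,r,$$ and if $M'$ is any pure $S$-module of type $d$, then $\beta(M')=q'\beta(M)$ for some rational $q'>0$. 3. $\beta(M)$ spans an extremal ray of the Boij–Söderberg cone of $S$: $\beta(M)\neq0$, and the ray $\mathbb Q_{\ge0}\,\beta(M)$ is a face of the cone, i.e. whenever a sum of two elements of the cone lies in this ray, both summands lie in it. -/

import Mathlib

open MvPolynomial

noncomputable section

namespace BoijSoderberg

universe u

/-- The polynomial ring `S = K[x_1, …, x_n]`, with its standard grading `deg x_i = 1`. -/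
abbrev PolyRing (K : Type u) [Field K] (n : ℕ) : Type u := MvPolynomial (Fin n) K

/-- A finitely generated `ℤ`-graded module `M = ⨁ M_j` over `S = K[x_1, …, x_n]`. -/
structure FGGradedModule (K : Type u) [Field K] (n : ℕ) where
  carrier : Type u
  [addCommGroup : AddCommGroup carrier]
  [module : Module (PolyRing K n) carrier]
  [finite : Module.Finite (PolyRing K n) carrier]
  /-- the graded piece `M_j` -/
  piece : ℤ → AddSubgroup carrier
  isInternal : DirectSum.IsInternal piece
  smul_mem : ∀ (k : ℕ) (p : PolyRing K n), p.IsHomogeneous k →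
    ∀ (j : ℤ) (m : carrier), m ∈ piece j → p • m ∈ piece ((k : ℤ) + j)

attribute [instance] FGGradedModule.addCommGroup FGGradedModule.module FGGradedModule.finite

variable {K : Type u} [Field K] {n : ℕ}

/-- `p ∈ S_j`, for an integer `j`: all monomials of `p` have degree `j` (so `p = 0` if `j < 0`). -/
def IsHomogeneousInt (p : PolyRing K n) (j : ℤ) : Prop :=
  ∀ e : Fin n →₀ ℕ, p.coeff e ≠ 0 → (e.degree : ℤ) = j

/-- `v` lies in the degree `j` piece of the graded free module `⨁_k S(-a_k)`, whose `k`-th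
generator has degree `a_k`. -/
def IsHomogeneousVec {b : ℕ} (a : Fin b → ℤ) (v : Fin b → PolyRing K n) (j : ℤ) : Prop :=
  ∀ k, IsHomogeneousInt (v k) (j - a k)

/-- A minimal graded free resolution `0 ← M ← F_0 ← F_1 ← ⋯` with
`F_i = ⨁_{k < rank i} S(- deg i k)`. All maps are homogeneous of degree `0` (it suffices to say so
on the generators), and minimality says that the image of `F_{i+1} → F_i` lies in
`(x_1, …, x_n) F_i`. -/
structure MinimalFreeResolution (M : FGGradedModule K n) where
  rank : ℕ → ℕ
  deg : (i : ℕ) → Fin (rank i) → ℤ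
  /-- the augmentation `F_0 → M` -/
  aug : (Fin (rank 0) → PolyRing K n) →ₗ[PolyRing K n] M.carrier
  /-- the differential `F_{i+1} → F_i` -/
  diff : (i : ℕ) → (Fin (rank (i + 1)) → PolyRing K n) →ₗ[PolyRing K n]
    (Fin (rank i) → PolyRing K n)
  aug_homogeneous : ∀ k, aug (Pi.single k 1) ∈ M.piece (deg 0 k)
  diff_homogeneous : ∀ i k, IsHomogeneousVec (deg i) (diff i (Pi.single k 1)) (deg (i + 1) k)
  aug_surjective : Function.Surjective aug
  exact_zero : LinearMap.range (diff 0) = LinearMap.ker aug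
  exact_succ : ∀ i, LinearMap.range (diff (i + 1)) = LinearMap.ker (diff i)
  minimal : ∀ i v k, diff i v k ∈ Ideal.span (Set.range (X : Fin n → PolyRing K n))

/-- The number of degree `j` generators of `F_i`, i.e. the exponent of `S(-j)` in `F_i`. -/
def MinimalFreeResolution.betti {M : FGGradedModule K n} (F : MinimalFreeResolution M)
    (i : ℕ) (j : ℤ) : ℕ :=
  Fintype.card {k : Fin (F.rank i) // F.deg i k = j}

open Classical in
/-- The graded Betti numbers `β_{i,j}(M)`: those of a minimal free resolution of `M`
(which always exists and is unique up to isomorphism; the value `0` is never taken by default). -/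
def bettiNumber (M : FGGradedModule K n) (i : ℕ) (j : ℤ) : ℕ :=
  if h : Nonempty (MinimalFreeResolution M) then h.some.betti i j else 0

/-- The Betti table `β(M)` as a vector with rational entries. -/
def bettiTable (M : FGGradedModule K n) : ℕ → ℤ → ℚ :=
  fun i j => (bettiNumber M i j : ℚ)

/-- `M` is pure of type `d = (d_0, …, d_r)`: it is Cohen–Macaulay of codimension `r`, that is,
`F_i = 0` for `i > r` and `dim M = n - r` (Krull dimension; it is `⊥` for `M = 0`), and `F_i` is
generated in degree `d_i` for `i = 0, …, r`. -/
structure IsPureOfType (M : FGGradedModule K n) {r : ℕ} (d : Fin (r + 1) → ℤ) : Prop where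
  dim_add : Module.supportDim (PolyRing K n) M.carrier + (r : WithBot ℕ∞) = (n : WithBot ℕ∞)
  length_le : ∀ i j, r < i → bettiNumber M i j = 0
  pure : ∀ (i : Fin (r + 1)) (j : ℤ), j ≠ d i → bettiNumber M i j = 0

variable (K n) in
/-- The Boij–Söderberg cone: the rational convex cone generated by the Betti tables of all finitely
generated graded `S`-modules. -/
def boijSoderbergCone : PointedCone ℚ (ℕ → ℤ → ℚ) :=
  PointedCone.hull ℚ (Set.range (bettiTable : FGGradedModule K n → ℕ → ℤ → ℚ))

/-- `v` spans an extremal ray of the cone `C`: it is nonzero, and the ray `ℚ_{≥ 0} v` is a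
face of `C`. -/
def SpansExtremalRay {V : Type*} [AddCommGroup V] [Module ℚ V] (C : PointedCone ℚ V) (v : V) :
    Prop :=
  v ≠ 0 ∧ (PointedCone.hull ℚ {v}).IsFaceOf C

end BoijSoderberg

end

/-! Everything comes from the cumulative Hilbert function h(j) = dim M_{≤ j}. If the Betti table of
M is supported on the positions (i, d_i), truncating a minimal resolution to degrees ≤ j keeps it
exact, so h(j) = Σ (-1)^i β_i binom(j - d_i + n, n) once j ≥ all d_i (`hilbertSum_bettiTable`). When
M has codimension r, Noether normalization bounds h by a polynomial of degree at most n - r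
(`exists_polynomial_bound`). Hence the top r coefficients of the right-hand side vanish, and these
are, up to a triangular change, the Herzog–Kühl power sums (`sum_mul_pow_eq_zero_of_growth`).

The equations say that Σ (-1)^i β_i p(d_i) = 0 for every polynomial p of degree < r. A p vanishing
at all nodes but two compares the two remaining β's; this gives the product formula and uniqueness
up to a factor. Minimality makes d strictly increasing once no F_i with i ≤ r vanishes. If one did,
a p vanishing at the remaining nodes of positive index would isolate β_0 and force F_0 = 0.

For extremality, let a x + y = t β(M) with x, y in the cone and a > 0. Entries are nonnegative, so
x, y and the tables they are built from are supported on the (i, d_i), and their Hilbert sums are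
nonnegative combinations of dimensions. The Hilbert sum of x thus lies between 0 and t/a times that
of M. This growth bound alone yields the Herzog–Kühl equations for x, although the modules behind x
are not assumed Cohen–Macaulay or of codimension r. By uniqueness x is a multiple of β(M). -/

noncomputable section

namespace BoijSoderberg

universe u

/-! ### Polynomial growth and the Herzog–Kühl linear system. -/

section Arithmetic

open Polynomial Filter

/-- A rational polynomial that is bounded by `U` at all large natural numbers has degree at most
that of `U`. -/
lemma natDegree_le_of_eventually_abs_le {q U : ℚ[X]}
    (h : ∀ᶠ j : ℕ in atTop, |q.eval (j : ℚ)| ≤ U.eval (j : ℚ)) : q.natDegree ≤ U.natDegree := by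
  by_contra! hlt
  have hq : q ≠ 0 := by rintro rfl; simp at hlt
  have hdeg : U.degree < q.degree := Polynomial.degree_lt_degree hlt
  -- U / q tends to 0, so eventually |U| < |q|, against the assumed bound.
  have h1 := (Polynomial.div_tendsto_atTop_zero_of_degree_lt U q hdeg).comp
    (tendsto_natCast_atTop_atTop (R := ℚ))
  have h2 := (tendsto_natCast_atTop_atTop (R := ℚ)).eventually
    (Polynomial.eventually_atTop_not_isRoot q hq)
  have h3 := h1.abs.eventually (gt_mem_nhds (show |(0 : ℚ)| < 1 by simp))
  obtain ⟨j, hj, hj2, hj3⟩ := (h.and (h2.and h3)).exists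
  have hpos : 0 < |q.eval (j : ℚ)| := abs_pos.mpr hj2
  simp only [Function.comp, abs_div] at hj3
  rw [div_lt_one hpos] at hj3
  exact absurd (lt_of_le_of_lt hj ((le_abs_self _).trans_lt hj3)) (lt_irrefl _)

/-- If the alternating sum of shifted Hilbert functions `j ↦ binom (j - dᵢ + n) n` grows at most
like a polynomial of degree `n - r`, then the first `r` power sums of the shifts vanish. -/
lemma sum_mul_pow_eq_zero_of_growth {ι : Type*} [Fintype ι] (c : ι → ℚ) (d : ι → ℤ) {n r : ℕ}
    (hr : r ≤ n) (U : ℚ[X]) (hU : U.natDegree ≤ n - r)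
    (h : ∀ᶠ j : ℕ in atTop,
      |∑ i, c i * (((((j : ℤ) - d i).toNat + n).choose n : ℕ) : ℚ)| ≤ U.eval (j : ℚ)) :
    ∀ s < r, ∑ i, c i * (d i : ℚ) ^ s = 0 := by
  -- B(j) = binom(j + n, n), so q agrees with the given sum as soon as j ≥ all d i.
  set B : ℚ[X] := preHilbertPoly ℚ n 0 with hB
  set q : ℚ[X] := ∑ i, Polynomial.C (c i) * taylor (-(d i : ℚ)) B with hq
  have hqdeg : q.natDegree ≤ n - r := by
    refine (natDegree_le_of_eventually_abs_le ?_).trans hU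
    have hlarge : ∀ᶠ j : ℕ in atTop, ∀ i, d i ≤ j := by
      rw [eventually_all]
      intro i
      filter_upwards [eventually_ge_atTop (d i).toNat] with j hj
      omega
    filter_upwards [h, hlarge] with j hj hl
    refine le_trans (le_of_eq ?_) hj
    congr 1
    rw [hq, eval_finsetSum]
    refine Finset.sum_congr rfl fun i _ => ?_
    rw [Polynomial.eval_mul, Polynomial.eval_C, taylor_eval]
    congr 1
    have h1 : (j : ℚ) + -(d i : ℚ) = (((j : ℤ) - d i).toNat : ℚ) := by
      have : ((((j : ℤ) - d i).toNat : ℤ) : ℚ) = ((j : ℤ) - d i : ℤ) := by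
        rw [Int.toNat_of_nonneg (by have := hl i; omega)]
      push_cast at this
      rw [this]; ring
    rw [h1, hB, preHilbertPoly_eq_choose_sub_add ℚ n (Nat.zero_le _), Nat.sub_zero]
  -- The coefficient of X^(n-s) in B(X - d) is a polynomial in d of degree exactly s. Given the
  -- vanishing of the lower power sums, only its leading term contributes.
  have hcoeff : ∀ s < r, ∑ i, c i * (hasseDeriv (n - s) B).eval (-(d i : ℚ)) = 0 := by
    intro s hs
    have : q.coeff (n - s) = 0 := coeff_eq_zero_of_natDegree_lt (by omega)
    rw [hq, finsetSum_coeff] at this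
    simpa [Polynomial.coeff_C_mul, taylor_coeff] using this
  intro s
  induction s using Nat.strong_induction_on with
  | _ s ih =>
    intro hs
    have h1 := hcoeff s hs
    have hdeg : (hasseDeriv (n - s) B).natDegree = s := by
      rw [natDegree_hasseDeriv, hB, natDegree_preHilbertPoly]; omega
    have hlead : (hasseDeriv (n - s) B).coeff s ≠ 0 := by
      rw [hasseDeriv_coeff, show s + (n - s) = n by omega, hB, coeff_preHilbertPoly_self]
      have : (n.choose (n - s) : ℚ) ≠ 0 := by
        exact_mod_cast (Nat.choose_pos (Nat.sub_le n s)).ne'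
      have h2 : ((n.factorial : ℚ))⁻¹ ≠ 0 := inv_ne_zero (by exact_mod_cast n.factorial_ne_zero)
      exact mul_ne_zero this h2
    simp only [eval_eq_sum_range, hdeg, Finset.mul_sum] at h1
    rw [Finset.sum_comm, Finset.sum_range_succ, Finset.sum_eq_zero, zero_add] at h1
    · have h3 : (hasseDeriv (n - s) B).coeff s * (-1) ^ s * ∑ i, c i * (d i : ℚ) ^ s = 0 := by
        rw [← h1, Finset.mul_sum]
        refine Finset.sum_congr rfl fun i _ => ?_
        rw [neg_pow (d i : ℚ)]; ring
      have h4 : (hasseDeriv (n - s) B).coeff s * (-1) ^ s ≠ 0 :=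
        mul_ne_zero hlead (pow_ne_zero _ (by norm_num))
      exact (mul_eq_zero.mp h3).resolve_left h4
    · intro t ht
      have htlt : t < s := Finset.mem_range.mp ht
      have h5 := ih t htlt (htlt.trans hs)
      calc ∑ i, c i * ((hasseDeriv (n - s) B).coeff t * (-(d i : ℚ)) ^ t)
          = (hasseDeriv (n - s) B).coeff t * (-1) ^ t * ∑ i, c i * (d i : ℚ) ^ t := by
            rw [Finset.mul_sum]
            refine Finset.sum_congr rfl fun i _ => ?_
            rw [neg_pow (d i : ℚ)]; ring
        _ = 0 := by rw [h5, mul_zero]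

/-- The power-sum equations combine linearly, so they can be tested on any polynomial of degree
below r, in particular on one with prescribed roots. -/
lemma sum_mul_eval_eq_zero {ι : Type*} [Fintype ι] {c x : ι → ℚ} {r : ℕ}
    (h : ∀ s < r, ∑ i, c i * x i ^ s = 0) {p : ℚ[X]} (hp : p.natDegree < r) :
    ∑ i, c i * p.eval (x i) = 0 := by
  simp only [eval_eq_sum_range, Finset.mul_sum]
  rw [Finset.sum_comm]
  refine Finset.sum_eq_zero fun t ht => ?_
  have := h t (by have := Finset.mem_range.mp ht; omega)
  calc ∑ i, c i * (p.coeff t * x i ^ t) = p.coeff t * ∑ i, c i * x i ^ t := by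
        rw [Finset.mul_sum]; exact Finset.sum_congr rfl fun i _ => by ring
    _ = 0 := by rw [this, mul_zero]

lemma natDegree_prod_X_sub_C_eq_card {ι : Type*} (s : Finset ι) (x : ι → ℚ) :
    (∏ j ∈ s, (Polynomial.X - Polynomial.C (x j))).natDegree = s.card := by
  rw [natDegree_prod _ _ fun j _ => X_sub_C_ne_zero _]
  simp

/-- The solutions of the Herzog–Kühl equations: `cᵢ ∏_{j ≠ i} (dᵢ - dⱼ)` does not depend on `i`. -/
lemma mul_prod_sub_eq_of_sum_mul_pow_eq_zero {r : ℕ} {c x : Fin (r + 1) → ℚ}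
    (h : ∀ s < r, ∑ i, c i * x i ^ s = 0) (i k : Fin (r + 1)) :
    c i * ∏ j ∈ Finset.univ.erase i, (x i - x j) =
      c k * ∏ j ∈ Finset.univ.erase k, (x k - x j) := by
  rcases eq_or_ne i k with rfl | hik
  · rfl
  set s : Finset (Fin (r + 1)) := (Finset.univ.erase i).erase k with hs
  have hk : k ∈ Finset.univ.erase i := by simp [hik.symm]
  have hi : i ∈ Finset.univ.erase k := by simp [hik]
  have hs' : s = (Finset.univ.erase k).erase i := Finset.erase_right_comm
  have hcard : s.card < r := by
    rw [hs, Finset.card_erase_of_mem hk, Finset.card_erase_of_mem (Finset.mem_univ _)]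
    simp
    -- The cardinality is r - 1 with truncated subtraction; r = 0 is impossible, as `Fin 1` has no i
    -- ≠ k.
    by_contra! h0
    have : r = 0 := by omega
    subst this
    exact hik (Fin.ext (by omega))
  -- The test polynomial kills every node except possibly x i and x k, so two terms survive.
  have h1 := sum_mul_eval_eq_zero h (p := ∏ j ∈ s, ((Polynomial.X : ℚ[X]) - Polynomial.C (x j)))
    (by rw [natDegree_prod_X_sub_C_eq_card]; exact hcard)
  simp only [Polynomial.eval_prod, Polynomial.eval_sub, Polynomial.eval_X, Polynomial.eval_C] at h1
  rw [← Finset.add_sum_erase _ _ (Finset.mem_univ i), ← Finset.add_sum_erase _ _ hk,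
    Finset.sum_eq_zero, add_zero] at h1
  · rw [← Finset.mul_prod_erase _ _ hk, ← Finset.mul_prod_erase _ _ hi, ← hs, ← hs']
    linear_combination (x i - x k) * h1
  · intro l hl
    rw [Finset.prod_eq_zero (i := l), mul_zero]
    · simp only [hs]; simp at hl ⊢; exact ⟨hl.1, hl.2⟩
    · simp

end Arithmetic

/-! ### Homogeneous components and truncations in graded free modules. -/

section GradedFree

variable {K : Type u} [Field K] {n : ℕ}

open Classical in
/-- The part of a polynomial supported on the monomials in `P`. -/
def monomialFilter (P : Set (Fin n →₀ ℕ)) : PolyRing K n →ₗ[K] PolyRing K n :=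
  (basisMonomials (Fin n) K).constr K fun e => if e ∈ P then monomial e 1 else 0

open Classical in
lemma monomialFilter_monomial (P : Set (Fin n →₀ ℕ)) (e : Fin n →₀ ℕ) :
    monomialFilter P (monomial e (1 : K)) = if e ∈ P then monomial e 1 else 0 := by
  have h : basisMonomials (Fin n) K e = monomial e 1 := congrFun (coe_basisMonomials _ _) e
  conv_lhs => rw [monomialFilter, ← h, Module.Basis.constr_basis]

open Classical in
lemma coeff_monomialFilter (P : Set (Fin n →₀ ℕ)) (p : PolyRing K n) (e : Fin n →₀ ℕ) :
    (monomialFilter P p).coeff e = if e ∈ P then p.coeff e else 0 := by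
  induction p using MvPolynomial.induction_on' with
  | monomial f c =>
    have : monomial f c = c • monomial f (1 : K) := by simp [smul_monomial]
    rw [this, map_smul, monomialFilter_monomial]
    by_cases hf : f ∈ P <;> by_cases hfe : f = e
    · subst hfe; simp [hf]
    · simp [hf, coeff_monomial, hfe]
    · subst hfe; simp [hf]
    · simp [hf, coeff_monomial, hfe]
  | add p q hp hq => rw [map_add, coeff_add, hp, hq, coeff_add]; split_ifs <;> simp

/-- The sum of the homogeneous components of degree in `T` of an element of `⨁_k S(-a_k)`. -/
def degreeFilter {b : ℕ} (a : Fin b → ℤ) (T : Set ℤ) :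
    (Fin b → PolyRing K n) →ₗ[K] (Fin b → PolyRing K n) :=
  LinearMap.pi fun k => (monomialFilter {e | (e.degree : ℤ) + a k ∈ T}).comp (LinearMap.proj k)

open Classical in
lemma coeff_degreeFilter {b : ℕ} (a : Fin b → ℤ) (T : Set ℤ) (v : Fin b → PolyRing K n)
    (k : Fin b) (e : Fin n →₀ ℕ) :
    (degreeFilter a T v k).coeff e = if (e.degree : ℤ) + a k ∈ T then (v k).coeff e else 0 :=
  coeff_monomialFilter _ _ _

lemma degreeFilter_homogeneous (b : ℕ) (a : Fin b → ℤ) (j : ℤ) (v : Fin b → PolyRing K n) :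
    IsHomogeneousVec a (degreeFilter a {j} v) j := by
  classical
  intro k e he
  rw [coeff_degreeFilter] at he
  have : (e.degree : ℤ) + a k = j := by
    by_contra h
    simp [h] at he
  omega

lemma degreeFilter_eq_self_of_support {b : ℕ} {a : Fin b → ℤ} {T : Set ℤ}
    {v : Fin b → PolyRing K n}
    (h : ∀ k e, (v k).coeff e ≠ 0 → (e.degree : ℤ) + a k ∈ T) : degreeFilter a T v = v := by
  classical
  funext k
  ext e
  rw [coeff_degreeFilter]
  by_cases h0 : (v k).coeff e = 0
  · simp [h0]
  · rw [if_pos (h k e h0)]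

lemma degreeFilter_eq_self {b : ℕ} {a : Fin b → ℤ} {T : Set ℤ} {j : ℤ}
    {v : Fin b → PolyRing K n} (hv : IsHomogeneousVec a v j) (hj : j ∈ T) :
    degreeFilter a T v = v := by
  refine degreeFilter_eq_self_of_support fun k e he => ?_
  have := hv k e he
  rwa [show (e.degree : ℤ) + a k = j by omega]

lemma degreeFilter_eq_zero {b : ℕ} {a : Fin b → ℤ} {T : Set ℤ} {j : ℤ}
    {v : Fin b → PolyRing K n} (hv : IsHomogeneousVec a v j) (hj : j ∉ T) :
    degreeFilter a T v = 0 := by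
  classical
  funext k
  ext e
  rw [coeff_degreeFilter]
  by_cases h0 : (v k).coeff e = 0
  · simp [h0]
  · have := hv k e h0
    rw [if_neg (by rwa [show (e.degree : ℤ) + a k = j by omega])]
    simp

lemma IsHomogeneousVec.monomial_smul {b : ℕ} {a : Fin b → ℤ} {j : ℤ} {v : Fin b → PolyRing K n}
    (hv : IsHomogeneousVec a v j) (e : Fin n →₀ ℕ) :
    IsHomogeneousVec a ((monomial e (1 : K)) • v) ((e.degree : ℤ) + j) := by
  classical
  intro k f hf
  rw [Pi.smul_apply, smul_eq_mul, coeff_monomial_mul'] at hf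
  have hle : e ≤ f := by
    by_contra h; simp [h] at hf
  rw [if_pos hle, one_mul] at hf
  have h1 := hv k _ hf
  have h2 : f.degree = e.degree + (f - e).degree := by
    rw [← map_add, add_tsub_cancel_of_le hle]
  omega

lemma isHomogeneousVec_single {b : ℕ} (a : Fin b → ℤ) (k : Fin b) (e : Fin n →₀ ℕ) :
    IsHomogeneousVec a (Pi.single k (monomial e (1 : K))) ((e.degree : ℤ) + a k) := by
  classical
  intro l f hf
  by_cases h : l = k
  · subst h
    rw [Pi.single_eq_same, coeff_monomial] at hf
    have : e = f := by by_contra h; simp [h] at hf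
    subst this; omega
  · simp [h] at hf

/-- Homogeneous maps commute with taking homogeneous components. -/
lemma map_degreeFilter {b b' : ℕ} {a : Fin b → ℤ} {a' : Fin b' → ℤ}
    (φ : (Fin b → PolyRing K n) →ₗ[PolyRing K n] (Fin b' → PolyRing K n))
    (hφ : ∀ k, IsHomogeneousVec a' (φ (Pi.single k 1)) (a k)) (T : Set ℤ)
    (v : Fin b → PolyRing K n) : φ (degreeFilter a T v) = degreeFilter a' T (φ v) := by
  classical
  have : (φ.restrictScalars K).comp (degreeFilter a T) =
      (degreeFilter a' T).comp (φ.restrictScalars K) := by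
    refine LinearMap.pi_ext' fun k => (basisMonomials (Fin n) K).ext fun e => ?_
    simp only [LinearMap.comp_apply, coe_basisMonomials, LinearMap.restrictScalars_apply,
      LinearMap.coe_single]
    have h1 : φ (Pi.single k (monomial e (1 : K))) = monomial e (1 : K) • φ (Pi.single k 1) := by
      rw [← map_smul, ← Pi.single_smul, smul_eq_mul, mul_one]
    have h2 : IsHomogeneousVec a' (φ (Pi.single k (monomial e (1 : K))))
        ((e.degree : ℤ) + a k) := by
      rw [h1]; exact (hφ k).monomial_smul e
    have h3 := isHomogeneousVec_single (K := K) a k e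
    by_cases hT : (e.degree : ℤ) + a k ∈ T
    · rw [degreeFilter_eq_self h3 hT, degreeFilter_eq_self h2 hT]
    · rw [degreeFilter_eq_zero h3 hT, degreeFilter_eq_zero h2 hT, map_zero]
  exact LinearMap.congr_fun this v

/-- Every element of a graded free module is the sum of its homogeneous components. -/
lemma exists_sum_degreeFilter_eq {b : ℕ} (a : Fin b → ℤ) (v : Fin b → PolyRing K n) :
    ∃ s : Finset ℤ, ∀ t, s ⊆ t → ∑ j ∈ t, degreeFilter a {j} v = v := by
  classical
  refine ⟨Finset.univ.biUnion fun k => (v k).support.image fun e => (e.degree : ℤ) + a k,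
    fun t ht => ?_⟩
  funext k
  ext e
  rw [Finset.sum_apply, coeff_sum]
  simp only [coeff_degreeFilter, Set.mem_singleton_iff]
  rw [Finset.sum_ite_eq]
  split_ifs with h
  · rfl
  · by_contra h0
    refine h (ht ?_)
    simp only [Finset.mem_biUnion, Finset.mem_univ, true_and, Finset.mem_image]
    exact ⟨k, e, by rw [mem_support_iff]; exact Ne.symm h0, rfl⟩

/-- The degree `j` piece of the graded free module `⨁_k S(-a_k)`. -/
def freePiece {b : ℕ} (a : Fin b → ℤ) (j : ℤ) : AddSubgroup (Fin b → PolyRing K n) where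
  carrier := {v | IsHomogeneousVec a v j}
  zero_mem' := by intro k e he; simp at he
  add_mem' := by
    intro v w hv hw k e he
    by_cases h : (v k).coeff e = 0
    · refine hw k e ?_
      rwa [Pi.add_apply, coeff_add, h, zero_add] at he
    · exact hv k e h
  neg_mem' := by
    intro v hv k e he
    refine hv k e ?_
    rwa [Pi.neg_apply, coeff_neg, neg_ne_zero] at he

lemma IsHomogeneousVec.smul {b : ℕ} {a : Fin b → ℤ} {j : ℤ} {v : Fin b → PolyRing K n}
    (hv : IsHomogeneousVec a v j) {d : ℕ} {p : PolyRing K n} (hp : p.IsHomogeneous d) :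
    IsHomogeneousVec a (p • v) ((d : ℤ) + j) := by
  have h1 : p • v = ∑ e ∈ p.support, p.coeff e • (monomial e (1 : K) • v) := by
    conv_lhs => rw [p.as_sum, Finset.sum_smul]
    refine Finset.sum_congr rfl fun e _ => ?_
    rw [← smul_assoc, smul_monomial, smul_eq_mul, mul_one]
  rw [h1]
  refine AddSubgroup.sum_mem (freePiece a ((d : ℤ) + j)) fun e he => ?_
  have h2 := hv.monomial_smul e
  have h3 : e.degree = d := by
    have := hp (mem_support_iff.mp he)
    exact (DFunLike.congr_fun Finsupp.degree_eq_weight_one e).trans this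
  rw [h3] at h2
  intro k f hf
  refine h2 k f fun h0 => hf ?_
  rw [Pi.smul_apply, coeff_smul, h0, smul_zero]

/-- The pieces of a graded free module are independent. -/
lemma freePiece_independent {b : ℕ} (a : Fin b → ℤ) (s : Finset ℤ)
    (m : ℤ → Fin b → PolyRing K n) (hm : ∀ j, m j ∈ freePiece a j) (h0 : ∑ j ∈ s, m j = 0) :
    ∀ j ∈ s, m j = 0 := by
  intro j hj
  have h1 : degreeFilter a {j} (∑ i ∈ s, m i) = m j := by
    rw [map_sum, Finset.sum_eq_single j]
    · exact degreeFilter_eq_self (hm j) rfl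
    · intro i _ hij
      exact degreeFilter_eq_zero (hm i) hij
    · exact fun h => absurd hj h
  rw [← h1, h0, map_zero]

/-- A map from a graded free module that sends the generators to homogeneous elements of the right
degree is homogeneous. -/
lemma map_mem_piece {M : Type*} [AddCommGroup M] [Module (PolyRing K n) M]
    {piece : ℤ → AddSubgroup M}
    (hsmul : ∀ (k : ℕ) (p : PolyRing K n), p.IsHomogeneous k →
      ∀ (j : ℤ) (m : M), m ∈ piece j → p • m ∈ piece ((k : ℤ) + j))
    {b : ℕ} {a : Fin b → ℤ} (φ : (Fin b → PolyRing K n) →ₗ[PolyRing K n] M)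
    (hφ : ∀ k, φ (Pi.single k 1) ∈ piece (a k)) {j : ℤ} {v : Fin b → PolyRing K n}
    (hv : IsHomogeneousVec a v j) : φ v ∈ piece j := by
  classical
  have h1 : φ v = ∑ k, v k • φ (Pi.single k 1) := by
    conv_lhs => rw [← Finset.univ_sum_single v, map_sum]
    refine Finset.sum_congr rfl fun k _ => ?_
    rw [← map_smul, ← Pi.single_smul, smul_eq_mul, mul_one]
  rw [h1]
  refine AddSubgroup.sum_mem _ fun k _ => ?_
  by_cases h0 : v k = 0
  · rw [h0, zero_smul]; exact zero_mem _
  · obtain ⟨e, he⟩ := MvPolynomial.ne_zero_iff.mp h0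
    have hd := hv k e he
    have hom : (v k).IsHomogeneous e.degree := by
      intro f hf
      have := hv k f hf
      exact (DFunLike.congr_fun Finsupp.degree_eq_weight_one f).symm.trans (by omega)
    have := hsmul _ _ hom _ _ (hφ k)
    rwa [show (e.degree : ℤ) + a k = j by omega] at this

/-- Kernels of homogeneous maps contain the homogeneous components of their elements. -/
lemma map_degreeFilter_eq_zero {M : Type*} [AddCommGroup M] [Module (PolyRing K n) M]
    {piece : ℤ → AddSubgroup M}
    (hsmul : ∀ (k : ℕ) (p : PolyRing K n), p.IsHomogeneous k →
      ∀ (j : ℤ) (m : M), m ∈ piece j → p • m ∈ piece ((k : ℤ) + j))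
    (hind : ∀ (s : Finset ℤ) (m : ℤ → M), (∀ j, m j ∈ piece j) → ∑ j ∈ s, m j = 0 →
      ∀ j ∈ s, m j = 0)
    {b : ℕ} {a : Fin b → ℤ} (φ : (Fin b → PolyRing K n) →ₗ[PolyRing K n] M)
    (hφ : ∀ k, φ (Pi.single k 1) ∈ piece (a k)) {v : Fin b → PolyRing K n} (hv : φ v = 0)
    (j : ℤ) : φ (degreeFilter a {j} v) = 0 := by
  obtain ⟨s, hs⟩ := exists_sum_degreeFilter_eq a v
  refine hind (insert j s) (fun i => φ (degreeFilter a {i} v))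
    (fun i => map_mem_piece hsmul φ hφ (degreeFilter_homogeneous _ _ _ _)) ?_ j
    (Finset.mem_insert_self _ _)
  rw [← map_sum, hs _ (Finset.subset_insert _ _), hv]

end GradedFree

/-! ### Existence of minimal graded free resolutions. -/

section Resolution

variable {K : Type u} [Field K] {n : ℕ}

lemma mem_span_X_iff_coeff_zero {p : PolyRing K n} :
    p ∈ Ideal.span (Set.range (X : Fin n → PolyRing K n)) ↔ p.coeff 0 = 0 := by
  rw [← Set.image_univ, mem_ideal_span_X_image]
  constructor
  · intro h
    by_contra h0
    obtain ⟨i, -, hi⟩ := h 0 (mem_support_iff.mpr h0)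
    exact hi rfl
  · intro h m hm
    by_contra! h0
    have : m = 0 := Finsupp.ext fun i => h0 i (Set.mem_univ i)
    subst this
    exact mem_support_iff.mp hm h

/-- A finitely generated module generated by homogeneous elements is the image of a graded free
module under a homogeneous map whose kernel is homogeneous and minimal. -/
lemma exists_minimal_presentation {M : Type*} [AddCommGroup M] [Module (PolyRing K n) M]
    {piece : ℤ → AddSubgroup M}
    (hsmul : ∀ (k : ℕ) (p : PolyRing K n), p.IsHomogeneous k →
      ∀ (j : ℤ) (m : M), m ∈ piece j → p • m ∈ piece ((k : ℤ) + j))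
    (hind : ∀ (s : Finset ℤ) (m : ℤ → M), (∀ j, m j ∈ piece j) → ∑ j ∈ s, m j = 0 →
      ∀ j ∈ s, m j = 0)
    (N : Submodule (PolyRing K n) M) (hfg : N.FG)
    (hN : N = Submodule.span (PolyRing K n) {x | x ∈ N ∧ ∃ j, x ∈ piece j}) :
    ∃ (b : ℕ) (a : Fin b → ℤ) (φ : (Fin b → PolyRing K n) →ₗ[PolyRing K n] M),
      LinearMap.range φ = N ∧ (∀ k, φ (Pi.single k 1) ∈ piece (a k)) ∧
      (∀ v, φ v = 0 → ∀ j, φ (degreeFilter a {j} v) = 0) ∧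
      (∀ v, φ v = 0 → ∀ k, v k ∈ Ideal.span (Set.range (X : Fin n → PolyRing K n))) := by
  classical
  have hex : ∃ b : ℕ, ∃ g : Fin b → M, (∀ k, ∃ j, g k ∈ piece j) ∧
      Submodule.span (PolyRing K n) (Set.range g) = N := by
    rw [hN] at hfg
    obtain ⟨s, hs, hspan⟩ := (Submodule.fg_span_iff_fg_span_finset_subset _).mp hfg
    refine ⟨s.card, fun k => (s.equivFin.symm k : M), fun k => (hs (s.equivFin.symm k).2).2, ?_⟩
    have : Set.range (fun k => (s.equivFin.symm k : M)) = s := by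
      ext x
      constructor
      · rintro ⟨k, rfl⟩; exact (s.equivFin.symm k).2
      · intro hx; exact ⟨s.equivFin ⟨x, hx⟩, by simp⟩
    rw [this, ← hspan, ← hN]
  -- Minimality comes from taking as few homogeneous generators as possible.
  obtain ⟨g, hg, hspan⟩ := Nat.find_spec hex
  have hmin : ∀ b' < Nat.find hex, ∀ g : Fin b' → M, (∀ k, ∃ j, g k ∈ piece j) →
      Submodule.span (PolyRing K n) (Set.range g) ≠ N :=
    fun b' hb' g hg h => Nat.find_min hex hb' ⟨g, hg, h⟩
  generalize Nat.find hex = b at g hg hspan hmin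
  choose a ha using hg
  have hsingle : ∀ k, Fintype.linearCombination (PolyRing K n) g (Pi.single k 1) = g k := by
    intro k
    rw [Fintype.linearCombination_apply_single, one_smul]
  have hker := fun v hv j => map_degreeFilter_eq_zero hsmul hind
    (Fintype.linearCombination (PolyRing K n) g) (fun k => by rw [hsingle]; exact ha k) (v := v) hv j
  refine ⟨b, a, Fintype.linearCombination (PolyRing K n) g, ?_, fun k => ?_, hker, ?_⟩
  · rw [Fintype.range_linearCombination, hspan]
  · rw [hsingle]; exact ha k
  · intro v hv k
    rw [mem_span_X_iff_coeff_zero]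
    by_contra hc
    obtain ⟨b', rfl⟩ : ∃ b', b = b' + 1 := ⟨b - 1, by have := k.2; omega⟩
    refine hmin b' (Nat.lt_succ_self _) (g ∘ k.succAbove) (fun l => ⟨_, ha _⟩) ?_
    rw [← hspan]
    refine le_antisymm (Submodule.span_mono (Set.range_comp_subset_range _ _)) ?_
    rw [Submodule.span_le]
    have hmem : ∀ l, g (k.succAbove l) ∈
        Submodule.span (PolyRing K n) (Set.range (g ∘ k.succAbove)) :=
      fun l => Submodule.subset_span ⟨l, rfl⟩
    rintro _ ⟨l, rfl⟩
    rcases Fin.eq_self_or_eq_succAbove k l with rfl | ⟨l, rfl⟩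
    swap
    · exact hmem l
    -- In the degree of g l, the relation v has a nonzero constant as its coefficient of g l.
    -- Dividing by it makes g l redundant, against the choice of b.
    set w := degreeFilter a {a l} v with hw
    have h1 : w l = C ((v l).coeff 0) := by
      ext e
      rw [hw, coeff_degreeFilter, coeff_C]
      by_cases he : e = 0
      · subst he; simp
      · have : ¬ ((e.degree : ℤ) + a l ∈ ({a l} : Set ℤ)) := by
          intro h
          have h2 : (e.degree : ℤ) = 0 := by
            have : (e.degree : ℤ) + a l = a l := h
            omega
          exact he ((Finsupp.degree_eq_zero_iff e).mp (by exact_mod_cast h2))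
        rw [if_neg this, if_neg (Ne.symm he)]
    have h2 : w l • g l + ∑ i, w (l.succAbove i) • g (l.succAbove i) = 0 := by
      have := hker v hv (a l)
      rwa [Fintype.linearCombination_apply, Fin.sum_univ_succAbove _ l] at this
    have h3 : g l = -((C ((v l).coeff 0)⁻¹ : PolyRing K n) •
        ∑ i, w (l.succAbove i) • g (l.succAbove i)) := by
      have h4 : (C ((v l).coeff 0)⁻¹ : PolyRing K n) • (w l • g l) = g l := by
        rw [← smul_assoc, h1, smul_eq_mul, ← C_mul, inv_mul_cancel₀ hc, C_1, one_smul]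
      rw [eq_neg_of_add_eq_zero_left h2, smul_neg] at h4
      exact h4.symm
    rw [h3]
    exact neg_mem (Submodule.smul_mem _ _ (Submodule.sum_mem _ fun i _ =>
      Submodule.smul_mem _ _ (hmem i)))

/-- A homogeneous submodule of a graded free module. -/
structure HomogeneousSubmodule (K : Type u) [Field K] (n : ℕ) where
  rank : ℕ
  deg : Fin rank → ℤ
  submodule : Submodule (PolyRing K n) (Fin rank → PolyRing K n)
  homogeneous : ∀ v ∈ submodule, ∀ j, degreeFilter deg {j} v ∈ submodule

lemma HomogeneousSubmodule.eq_span (N : HomogeneousSubmodule K n) :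
    N.submodule = Submodule.span (PolyRing K n)
      {x | x ∈ N.submodule ∧ ∃ j, x ∈ freePiece N.deg j} := by
  refine le_antisymm (fun v hv => ?_) (Submodule.span_le.mpr fun x hx => hx.1)
  obtain ⟨s, hs⟩ := exists_sum_degreeFilter_eq N.deg v
  rw [← hs s subset_rfl]
  exact Submodule.sum_mem _ fun j _ => Submodule.subset_span
    ⟨N.homogeneous v hv j, j, degreeFilter_homogeneous _ _ _ _⟩

/-- One step of the resolution. The kernel is again a homogeneous submodule of a graded free module,
finitely generated because S is Noetherian, so the step can be iterated. -/
lemma HomogeneousSubmodule.exists_syzygies (N : HomogeneousSubmodule K n) :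
    ∃ (N' : HomogeneousSubmodule K n)
      (φ : (Fin N'.rank → PolyRing K n) →ₗ[PolyRing K n] (Fin N.rank → PolyRing K n)),
      LinearMap.range φ = N.submodule ∧ LinearMap.ker φ = N'.submodule ∧
      (∀ k, IsHomogeneousVec N.deg (φ (Pi.single k 1)) (N'.deg k)) ∧
      (∀ v ∈ N'.submodule, ∀ k, v k ∈ Ideal.span (Set.range (X : Fin n → PolyRing K n))) := by
  obtain ⟨b, a, φ, h1, h2, h3, h4⟩ := exists_minimal_presentation (piece := freePiece N.deg)
    (fun k p hp j m hm => IsHomogeneousVec.smul hm hp) (freePiece_independent N.deg) N.submodule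
    (IsNoetherian.noetherian _) N.eq_span
  exact ⟨⟨b, a, LinearMap.ker φ, fun v hv j => h3 v hv j⟩, φ, h1, rfl, h2, h4⟩

lemma FGGradedModule.independent (M : FGGradedModule K n) (s : Finset ℤ) (m : ℤ → M.carrier)
    (hm : ∀ j, m j ∈ M.piece j) (h0 : ∑ j ∈ s, m j = 0) : ∀ j ∈ s, m j = 0 := by
  classical
  have h := M.isInternal.1
  set x : DirectSum ℤ fun j => M.piece j := ∑ j ∈ s, DirectSum.of (fun j => M.piece j) j ⟨m j, hm j⟩
    with hx
  have h1 : x = 0 := by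
    apply h
    rw [map_zero, hx, map_sum, ← h0]
    exact Finset.sum_congr rfl fun j _ => DirectSum.coeAddMonoidHom_of _ _ _
  intro j hj
  have h2 : (x j : M.carrier) = m j := by
    rw [hx, DFinsupp.finsetSum_apply, Finset.sum_eq_single j]
    · rw [DirectSum.of_eq_same]
    · intro i _ hij
      exact DirectSum.of_eq_of_ne _ _ _ hij.symm
    · exact fun h => absurd hj h
  rw [← h2, h1]; rfl

lemma FGGradedModule.span_homogeneous (M : FGGradedModule K n) :
    (⊤ : Submodule (PolyRing K n) M.carrier) =
      Submodule.span (PolyRing K n) {x | x ∈ (⊤ : Submodule (PolyRing K n) M.carrier) ∧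
        ∃ j, x ∈ M.piece j} := by
  classical
  refine le_antisymm (fun v _ => ?_) le_top
  obtain ⟨x, rfl⟩ := M.isInternal.2 v
  induction x using DirectSum.induction_on with
  | zero => rw [map_zero]; exact zero_mem _
  | of i x =>
    rw [DirectSum.coeAddMonoidHom_of]
    exact Submodule.subset_span ⟨trivial, i, x.2⟩
  | add x y hx hy => rw [map_add]; exact add_mem (hx trivial) (hy trivial)

/-- Every finitely generated graded module has a minimal graded free resolution. -/
theorem nonempty_minimalFreeResolution (M : FGGradedModule K n) :
    Nonempty (MinimalFreeResolution M) := by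
  obtain ⟨b, a, aug, h1, h2, h3, h4⟩ := exists_minimal_presentation (piece := M.piece)
    M.smul_mem M.independent ⊤ Module.Finite.fg_top M.span_homogeneous
  choose next φ hrange hker hhom hmin using
    HomogeneousSubmodule.exists_syzygies (K := K) (n := n)
  -- N i is the syzygy module inside F_i: the kernel of the augmentation for i = 0, then the kernel
  -- of the previous differential.
  let N : ℕ → HomogeneousSubmodule K n := fun i =>
    Nat.rec ⟨b, a, LinearMap.ker aug, fun v hv j => h3 v hv j⟩ (fun _ => next) i
  exact ⟨{
    rank := fun i => (N i).rank
    deg := fun i => (N i).deg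
    aug := aug
    diff := fun i => φ (N i)
    aug_homogeneous := h2
    diff_homogeneous := fun i k => hhom (N i) k
    aug_surjective := LinearMap.range_eq_top.mp h1
    exact_zero := hrange (N 0)
    exact_succ := fun i => (hrange (N (i + 1))).trans (hker (N i)).symm
    minimal := fun i v => by
      have hv : φ (N i) v ∈ (N i).submodule := by
        rw [← hrange (N i)]; exact ⟨v, rfl⟩
      cases i with
      | zero => exact h4 _ hv
      | succ i => exact hmin (N i) _ hv }⟩

end Resolution

/-! ### Noether normalization and the growth of the Hilbert function. -/

section Growth

lemma sum_range_multichoose (n m : ℕ) :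
    ∑ d ∈ Finset.range (m + 1), n.multichoose d = (n + 1).multichoose m := by
  induction m with
  | zero => simp
  | succ m ih => rw [Finset.sum_range_succ, ih, Nat.multichoose_succ_succ, add_comm]

/-- Counts monomials degree by degree and sums by the hockey-stick identity. -/
lemma card_degree_le (n m : ℕ) :
    Nat.card {e : Fin n →₀ ℕ | (e.sum fun _ k => k) ≤ m} = (m + n).choose n := by
  classical
  have h1 : {e : Fin n →₀ ℕ | (e.sum fun _ k => k) ≤ m} =
      ((Finset.range (m + 1)).biUnion fun d => (Finset.univ : Finset (Fin n)).finsuppAntidiag d :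
        Finset (Fin n →₀ ℕ)) := by
    ext e
    simp [Finset.mem_finsuppAntidiag, Finsupp.sum_fintype]
  rw [h1, Nat.card_coe_set_eq, Set.ncard_coe_finset, Finset.card_biUnion]
  · simp_rw [Finset.card_finsuppAntidiag_nat_eq_multichoose]
    rw [Finset.card_univ, Fintype.card_fin, sum_range_multichoose, Nat.multichoose_eq]
    rw [show n + 1 + m - 1 = m + n by omega]
    exact Nat.choose_symm_add.symm ▸ rfl
  · intro i _ j _ hij
    rw [Function.onFun, Finset.disjoint_left]
    intro e he he'
    rw [Finset.mem_finsuppAntidiag] at he he'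
    exact hij (he.1.symm.trans he'.1)

lemma finrank_restrictTotalDegree (K : Type*) [Field K] (n m : ℕ) :
    Module.finrank K (restrictTotalDegree (Fin n) K m) = (m + n).choose n := by
  exact (Module.finrank_eq_nat_card_basis (basisRestrictSupport K _)).trans (card_degree_le n m)

/-- An integral ring extension does not lower the Krull dimension. -/
lemma ringKrullDim_le_of_isIntegral {R A : Type*} [CommRing R] [CommRing A] [Algebra R A]
    [Algebra.IsIntegral R A] (hinj : Function.Injective (algebraMap R A)) :
    ringKrullDim R ≤ ringKrullDim A := by
  refine iSup_le fun l => ?_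
  obtain ⟨Q, _, hQ, hcomap⟩ := Ideal.exists_ideal_over_prime_of_isIntegral
    (RelSeries.head l).asIdeal (⊥ : Ideal A)
    (by rw [← RingHom.ker_eq_comap_bot, (RingHom.injective_iff_ker_eq_bot _).mp hinj]
        exact bot_le)
  have : Q.LiesOver (RelSeries.head l).asIdeal := ⟨hcomap.symm⟩
  obtain ⟨L, hL, -⟩ := Ideal.exists_ltSeries_of_hasGoingUp l Q
  rw [← hL]
  exact Order.LTSeries.length_le_krullDim L

/-- Noether normalization, with a bound on the number of variables. -/
lemma exists_noether_normalization_of_finiteType (K A : Type*) [Field K] [CommRing A]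
    [Nontrivial A] [Algebra K A] [Algebra.FiniteType K A] :
    ∃ (s : ℕ) (g : MvPolynomial (Fin s) K →ₐ[K] A), (s : WithBot ℕ∞) ≤ ringKrullDim A ∧
      ∃ (l : ℕ) (α : Fin l → A), ∀ x, ∃ p : Fin l → MvPolynomial (Fin s) K,
        x = ∑ i, g (p i) * α i := by
  obtain ⟨s, g, hinj, hfin⟩ := exists_finite_inj_algHom_of_fg K A
  let _ : Algebra (MvPolynomial (Fin s) K) A := g.toRingHom.toAlgebra
  have : Module.Finite (MvPolynomial (Fin s) K) A := hfin
  refine ⟨s, g, ?_, ?_⟩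
  · have h1 : ringKrullDim (MvPolynomial (Fin s) K) ≤ ringKrullDim A :=
      ringKrullDim_le_of_isIntegral hinj
    rwa [MvPolynomial.ringKrullDim_of_isNoetherianRing, ringKrullDim_eq_zero_of_field, zero_add,
      Nat.card_eq_fintype_card, Fintype.card_fin] at h1
  · obtain ⟨l, α, hα⟩ := Module.Finite.exists_fin (R := MvPolynomial (Fin s) K) (M := A)
    refine ⟨l, α, fun x => ?_⟩
    have hx : x ∈ Submodule.span (MvPolynomial (Fin s) K) (Set.range α) := by rw [hα]; trivial
    obtain ⟨p, hp⟩ := (Submodule.mem_span_range_iff_exists_fun _).mp hx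
    refine ⟨p, hp.symm.trans (Finset.sum_congr rfl fun i _ => ?_)⟩
    rw [Algebra.smul_def]; rfl

variable {K : Type u} [Field K] {n : ℕ}

/-- Noether normalization for a module: a module of codimension `r` over `K[x_1, …, x_n]` is finite
over a polynomial ring in at most `n - r` variables. -/
lemma exists_noether_normalization {M : Type*} [AddCommGroup M] [Module (PolyRing K n) M]
    [Module.Finite (PolyRing K n) M] {r : ℕ}
    (hdim : Module.supportDim (PolyRing K n) M + (r : WithBot ℕ∞) = (n : WithBot ℕ∞)) :
    ∃ (s : ℕ) (ψ : MvPolynomial (Fin s) K →ₐ[K] PolyRing K n) (k : ℕ) (m : Fin k → M),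
      s + r ≤ n ∧ ∀ x : M, ∃ p : Fin k → MvPolynomial (Fin s) K, x = ∑ b, ψ (p b) • m b := by
  classical
  set I := Module.annihilator (PolyRing K n) M with hI
  rw [Module.supportDim_eq_ringKrullDim_quotient_annihilator, ← hI] at hdim
  -- For M = 0 the dimension is ⊥, and ⊥ + r is not n.
  have hnt : Nontrivial (PolyRing K n ⧸ I) := by
    by_contra h
    rw [not_nontrivial_iff_subsingleton] at h
    rw [ringKrullDim_eq_bot_of_subsingleton, WithBot.bot_add] at hdim
    exact absurd hdim (by exact WithBot.bot_ne_coe)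
  obtain ⟨s, g, hs, l, α, hα⟩ := exists_noether_normalization_of_finiteType K (PolyRing K n ⧸ I)
  -- The normalization is lifted from S / I to S. Modulo the annihilator the lift agrees with g, so
  -- it acts on M in the same way; it need not be homogeneous.
  choose y hy using fun i => Ideal.Quotient.mk_surjective (g (X i))
  set ψ : MvPolynomial (Fin s) K →ₐ[K] PolyRing K n := aeval y
  have hψ : ∀ p, Ideal.Quotient.mk I (ψ p) = g p := by
    have : (Ideal.Quotient.mkₐ K I).comp ψ = g := by
      refine MvPolynomial.algHom_ext fun i => ?_
      simp [ψ, hy]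
    exact fun p => DFunLike.congr_fun this p
  have hdims : s + r ≤ n := by
    have h2 := add_le_add_left hs (r : WithBot ℕ∞)
    rw [hdim] at h2
    exact_mod_cast h2
  obtain ⟨t, m, hm⟩ := Module.Finite.exists_fin (R := PolyRing K n) (M := M)
  choose β hβ using fun i => Ideal.Quotient.mk_surjective (α i)
  refine ⟨s, ψ, t * l, fun b => β (finProdFinEquiv.symm b).2 • m (finProdFinEquiv.symm b).1,
    hdims, fun x => ?_⟩
  have hx : x ∈ Submodule.span (PolyRing K n) (Set.range m) := by rw [hm]; trivial
  obtain ⟨c, hc⟩ := (Submodule.mem_span_range_iff_exists_fun _).mp hx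
  choose p hp using fun a => hα (Ideal.Quotient.mk I (c a))
  refine ⟨fun b => p (finProdFinEquiv.symm b).1 (finProdFinEquiv.symm b).2, ?_⟩
  rw [← finProdFinEquiv.sum_comp]
  simp only [Equiv.symm_apply_apply]
  rw [Fintype.sum_prod_type, ← hc]
  refine Finset.sum_congr rfl fun a _ => ?_
  have h1 : c a - ∑ i, ψ (p a i) * β i ∈ I := by
    rw [← Ideal.Quotient.eq_zero_iff_mem, map_sub, hp a, map_sum, sub_eq_zero]
    refine Finset.sum_congr rfl fun i _ => ?_
    rw [map_mul, hψ, hβ]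
  have h2 := Module.mem_annihilator.mp h1 (m a)
  rw [sub_smul, sub_eq_zero] at h2
  rw [h2, Finset.sum_smul]
  exact Finset.sum_congr rfl fun i _ => mul_smul _ _ _

variable {M : Type*} [AddCommGroup M] [Module (PolyRing K n) M] [Module K M]
  [IsScalarTower K (PolyRing K n) M]

/-- The subspace of combinations of the `m_b` with coefficients of degree at most `e` in a
polynomial ring acting through `ψ`. -/
def combinationsOfDegreeLE {s k : ℕ} (ψ : MvPolynomial (Fin s) K →ₐ[K] PolyRing K n)
    (m : Fin k → M) (e : ℕ) : Submodule K M :=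
  LinearMap.range (∑ b, ((LinearMap.toSpanSingleton (PolyRing K n) M (m b)).restrictScalars K).comp
    (ψ.toLinearMap.comp ((restrictTotalDegree (Fin s) K e).subtype.comp (LinearMap.proj b))) :
    (Fin k → restrictTotalDegree (Fin s) K e) →ₗ[K] M)

lemma mem_combinationsOfDegreeLE {s k : ℕ} {ψ : MvPolynomial (Fin s) K →ₐ[K] PolyRing K n}
    {m : Fin k → M} {e : ℕ} {x : M} : x ∈ combinationsOfDegreeLE ψ m e ↔
      ∃ p : Fin k → MvPolynomial (Fin s) K, (∀ b, (p b).totalDegree ≤ e) ∧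
        x = ∑ b, ψ (p b) • m b := by
  constructor
  · rintro ⟨p, rfl⟩
    refine ⟨fun b => p b, fun b => (mem_restrictTotalDegree _ _ _).mp (p b).2, ?_⟩
    simp [LinearMap.sum_apply]
  · rintro ⟨p, hp, rfl⟩
    refine ⟨fun b => ⟨p b, (mem_restrictTotalDegree _ _ _).mpr (hp b)⟩, ?_⟩
    simp [LinearMap.sum_apply]

instance {s k : ℕ} (ψ : MvPolynomial (Fin s) K →ₐ[K] PolyRing K n) (m : Fin k → M) (e : ℕ) :
    Module.Finite K (combinationsOfDegreeLE ψ m e) := by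
  unfold combinationsOfDegreeLE; infer_instance

lemma finrank_combinationsOfDegreeLE_le {s k : ℕ} (ψ : MvPolynomial (Fin s) K →ₐ[K] PolyRing K n)
    (m : Fin k → M) (e : ℕ) :
    Module.finrank K (combinationsOfDegreeLE ψ m e) ≤ k * (e + s).choose s := by
  refine (LinearMap.finrank_range_le _).trans ?_
  rw [Module.finrank_pi_fintype]
  simp [finrank_restrictTotalDegree]

section

variable {s k : ℕ} {ψ : MvPolynomial (Fin s) K →ₐ[K] PolyRing K n} {m : Fin k → M}

lemma combinationsOfDegreeLE_mono {e e' : ℕ} (h : e ≤ e') :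
    combinationsOfDegreeLE ψ m e ≤ combinationsOfDegreeLE ψ m e' := by
  intro x hx
  obtain ⟨p, hp, rfl⟩ := mem_combinationsOfDegreeLE.mp hx
  exact mem_combinationsOfDegreeLE.mpr ⟨p, fun b => (hp b).trans h, rfl⟩

lemma smul_mem_combinationsOfDegreeLE {p : MvPolynomial (Fin s) K} {d e : ℕ}
    (hp : p.totalDegree ≤ d) {x : M} (hx : x ∈ combinationsOfDegreeLE ψ m e) :
    ψ p • x ∈ combinationsOfDegreeLE ψ m (d + e) := by
  obtain ⟨q, hq, rfl⟩ := mem_combinationsOfDegreeLE.mp hx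
  refine mem_combinationsOfDegreeLE.mpr ⟨fun b => p * q b,
    fun b => (totalDegree_mul _ _).trans (add_le_add hp (hq b)), ?_⟩
  rw [Finset.smul_sum]
  exact Finset.sum_congr rfl fun b _ => by rw [map_mul, mul_smul]

lemma exists_mem_combinationsOfDegreeLE {ι : Type*} [Fintype ι]
    (hm : ∀ x : M, ∃ p : Fin k → MvPolynomial (Fin s) K, x = ∑ b, ψ (p b) • m b) (x : ι → M) :
    ∃ e, ∀ i, x i ∈ combinationsOfDegreeLE ψ m e := by
  choose p hp using fun i => hm (x i)
  refine ⟨∑ i, ∑ b, (p i b).totalDegree, fun i => mem_combinationsOfDegreeLE.mpr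
    ⟨p i, fun b => ?_, hp i⟩⟩
  exact (Finset.single_le_sum (f := fun b => (p i b).totalDegree) (fun _ _ => Nat.zero_le _)
    (Finset.mem_univ b)).trans (Finset.single_le_sum (f := fun i => ∑ b, (p i b).totalDegree)
    (fun _ _ => Nat.zero_le _) (Finset.mem_univ i))

/-- The finitely many products x_i m_b all lie in one step c of the filtration. So each variable
raises the filtration by at most c, and a polynomial of degree t by at most c t. -/
lemma exists_smul_mem_combinationsOfDegreeLE
    (hm : ∀ x : M, ∃ p : Fin k → MvPolynomial (Fin s) K, x = ∑ b, ψ (p b) • m b) :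
    ∃ c, ∀ (v : PolyRing K n) (e t : ℕ) (x : M), v.totalDegree ≤ t →
      x ∈ combinationsOfDegreeLE ψ m e → v • x ∈ combinationsOfDegreeLE ψ m (e + c * t) := by
  classical
  obtain ⟨c, hc⟩ := exists_mem_combinationsOfDegreeLE hm
    (fun ib : Fin n × Fin k => (X ib.1 : PolyRing K n) • m ib.2)
  have hX : ∀ (i : Fin n) (e : ℕ) (x : M), x ∈ combinationsOfDegreeLE ψ m e →
      (X i : PolyRing K n) • x ∈ combinationsOfDegreeLE ψ m (e + c) := by
    intro i e x hx
    obtain ⟨p, hp, rfl⟩ := mem_combinationsOfDegreeLE.mp hx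
    rw [Finset.smul_sum]
    refine Submodule.sum_mem _ fun b _ => ?_
    rw [smul_comm]
    exact smul_mem_combinationsOfDegreeLE (hp b) (hc (i, b))
  have hmon : ∀ (f : Fin n →₀ ℕ) (e : ℕ) (x : M), x ∈ combinationsOfDegreeLE ψ m e →
      (monomial f (1 : K) : PolyRing K n) • x ∈
        combinationsOfDegreeLE ψ m (e + c * f.degree) := by
    intro f
    induction f using Finsupp.induction_linear with
    | zero =>
      intro e x hx
      have h1 : (monomial (0 : Fin n →₀ ℕ) (1 : K)) = 1 := rfl
      rw [h1, one_smul]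
      exact combinationsOfDegreeLE_mono (Nat.le_add_right _ _) hx
    | add f g hf hg =>
      intro e x hx
      have h1 : (monomial (f + g) (1 : K)) = monomial f 1 * monomial g 1 := by
        rw [monomial_mul, one_mul]
      rw [h1, mul_smul]
      have := hf _ _ (hg _ _ hx)
      rwa [show e + c * g.degree + c * f.degree = e + c * (f + g).degree by
        rw [map_add]; ring] at this
    | single i j =>
      induction j with
      | zero =>
        intro e x hx
        have h1 : (monomial (Finsupp.single i 0) (1 : K)) = 1 := by simp
        rw [h1, one_smul]
        exact combinationsOfDegreeLE_mono (Nat.le_add_right _ _) hx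
      | succ j ih =>
        intro e x hx
        have h1 : (monomial (Finsupp.single i (j + 1)) (1 : K)) =
            X i * monomial (Finsupp.single i j) 1 := by
          rw [X, monomial_mul, one_mul, ← Finsupp.single_add, add_comm]
        rw [h1, mul_smul]
        have := hX i _ _ (ih e x hx)
        rw [Finsupp.degree_single] at this ⊢
        rwa [show e + c * j + c = e + c * (j + 1) by ring] at this
  refine ⟨c, fun v e t x hv hx => ?_⟩
  have h1 : v • x = ∑ f ∈ v.support, v.coeff f • (monomial f (1 : K) : PolyRing K n) • x := by
    conv_lhs => rw [v.as_sum, Finset.sum_smul]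
    refine Finset.sum_congr rfl fun f _ => ?_
    rw [← smul_assoc, smul_monomial, smul_eq_mul, mul_one]
  rw [h1]
  refine Submodule.sum_mem _ fun f hf => Submodule.smul_mem _ _ ?_
  refine combinationsOfDegreeLE_mono ?_ (hmon f e x hx)
  have : f.degree ≤ t := (le_totalDegree hf).trans hv
  gcongr

end

/-- The Hilbert function of a module of codimension `r` over `K[x_1, …, x_n]` grows at most like a
polynomial of degree `n - r`. -/
lemma exists_polynomial_bound [Module.Finite (PolyRing K n) M] {r : ℕ}
    (hdim : Module.supportDim (PolyRing K n) M + (r : WithBot ℕ∞) = (n : WithBot ℕ∞))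
    {b : ℕ} (g : Fin b → M) :
    r ≤ n ∧ ∃ U : Polynomial ℚ, U.natDegree ≤ n - r ∧ ∀ (t : ℕ) (W : Submodule K M),
      (∀ x ∈ W, ∃ v : Fin b → PolyRing K n, (∀ i, (v i).totalDegree ≤ t) ∧
        x = ∑ i, v i • g i) → (Module.finrank K W : ℚ) ≤ U.eval (t : ℚ) := by
  obtain ⟨s, ψ, k, m, hs, hm⟩ := exists_noether_normalization hdim
  obtain ⟨c, hc⟩ := exists_smul_mem_combinationsOfDegreeLE hm
  obtain ⟨e, he⟩ := exists_mem_combinationsOfDegreeLE hm g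
  -- U(t) = k binom(c t + e + s, s), of degree at most s ≤ n - r; here e is a filtration step
  -- containing all g i.
  refine ⟨by omega, Polynomial.C (k : ℚ) * (Polynomial.preHilbertPoly ℚ s 0).comp
    (Polynomial.C (c : ℚ) * Polynomial.X + Polynomial.C (e : ℚ)), ?_, fun t W hW => ?_⟩
  · refine (Polynomial.natDegree_C_mul_le _ _).trans (Polynomial.natDegree_comp_le.trans ?_)
    rw [Polynomial.natDegree_preHilbertPoly]
    have h1 : (Polynomial.C (c : ℚ) * Polynomial.X + Polynomial.C (e : ℚ)).natDegree ≤ 1 :=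
      Polynomial.natDegree_linear_le
    calc s * _ ≤ s * 1 := Nat.mul_le_mul_left _ h1
      _ ≤ n - r := by omega
  · have h1 : W ≤ combinationsOfDegreeLE ψ m (e + c * t) := by
      intro x hx
      obtain ⟨v, hv, rfl⟩ := hW x hx
      exact Submodule.sum_mem _ fun i _ => hc _ _ _ _ (hv i) (he i)
    have h2 := (Submodule.finrank_mono h1).trans (finrank_combinationsOfDegreeLE_le ψ m _)
    have h3 : (c : ℚ) * t + e = ((e + c * t : ℕ) : ℚ) := by push_cast; ring
    simp only [Polynomial.eval_mul, Polynomial.eval_C, Polynomial.eval_comp, Polynomial.eval_add,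
      Polynomial.eval_X]
    rw [h3, Polynomial.preHilbertPoly_eq_choose_sub_add ℚ s (Nat.zero_le _), Nat.sub_zero]
    exact_mod_cast h2

end Growth

/-! ### Truncated resolutions and the alternating sum of dimensions. -/

section Strand

variable {K : Type u} [Field K] {n : ℕ}

instance (M : FGGradedModule K n) : Module K M.carrier :=
  Module.compHom M.carrier (algebraMap K (PolyRing K n))

instance (M : FGGradedModule K n) : IsScalarTower K (PolyRing K n) M.carrier :=
  IsScalarTower.of_algebraMap_smul fun _ _ => rfl

/-- The vectors of polynomials of degree at most `t`. -/
def vectorsOfDegreeLE (K : Type u) [Field K] (n b t : ℕ) : Submodule K (Fin b → PolyRing K n) :=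
  Submodule.pi Set.univ fun _ => restrictTotalDegree (Fin n) K t

lemma mem_vectorsOfDegreeLE {b t : ℕ} {v : Fin b → PolyRing K n} :
    v ∈ vectorsOfDegreeLE K n b t ↔ ∀ k, (v k).totalDegree ≤ t := by
  simp [vectorsOfDegreeLE, Submodule.mem_pi, mem_restrictTotalDegree]

/-- A vector of polynomials of degree at most `t`, coordinatewise. -/
def vectorsOfDegreeLEEquiv (K : Type u) [Field K] (n b t : ℕ) :
    vectorsOfDegreeLE K n b t ≃ₗ[K] (Fin b → restrictTotalDegree (Fin n) K t) where
  toFun v k := ⟨v.1 k, v.2 k trivial⟩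
  invFun w := ⟨fun k => w k, fun k _ => (w k).2⟩
  map_add' _ _ := rfl
  map_smul' _ _ := rfl
  left_inv _ := rfl
  right_inv _ := rfl

instance (b t : ℕ) : Module.Finite K (vectorsOfDegreeLE K n b t) :=
  Module.Finite.equiv (vectorsOfDegreeLEEquiv K n b t).symm

lemma finrank_vectorsOfDegreeLE (b t : ℕ) :
    Module.finrank K (vectorsOfDegreeLE K n b t) = b * (t + n).choose n := by
  rw [(vectorsOfDegreeLEEquiv K n b t).finrank_eq, Module.finrank_pi_fintype]
  simp [finrank_restrictTotalDegree]

lemma finrank_map_add_finrank_inf_ker {V W : Type*} [AddCommGroup V] [Module K V]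
    [AddCommGroup W] [Module K W] (f : V →ₗ[K] W) (U : Submodule K V) [Module.Finite K U] :
    Module.finrank K (U.map f) + Module.finrank K (U ⊓ LinearMap.ker f : Submodule K V) =
      Module.finrank K U := by
  have h := (f.domRestrict U).finrank_range_add_finrank_ker
  rw [LinearMap.range_domRestrict, LinearMap.ker_domRestrict] at h
  rw [← h]
  congr 1
  rw [← Submodule.map_comap_subtype]
  exact Submodule.finrank_map_subtype_eq U _

/-- With all generators in one degree D, graded degree at most j means total degree at most j - D in
each coordinate. -/
lemma degreeFilter_Iic_mem {b : ℕ} {a : Fin b → ℤ} {D j : ℤ} (ha : ∀ k, a k = D)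
    (v : Fin b → PolyRing K n) :
    degreeFilter a (Set.Iic j) v ∈ vectorsOfDegreeLE K n b (j - D).toNat := by
  classical
  rw [mem_vectorsOfDegreeLE]
  intro k
  rw [totalDegree, Finset.sup_le_iff]
  intro e he
  rw [mem_support_iff, coeff_degreeFilter] at he
  have h1 : (e.degree : ℤ) + a k ≤ j := by
    by_contra h
    exact he (if_neg h)
  rw [ha] at h1
  have h2 : (e.sum fun _ i => i) = e.degree := rfl
  omega

/-- The bound D ≤ j matters: otherwise `toNat` gives 0 and leaves the constants, whose degree D
exceeds j. -/
lemma degreeFilter_Iic_eq_self {b : ℕ} {a : Fin b → ℤ} {D j : ℤ} (ha : ∀ k, a k = D)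
    (hj : D ≤ j) {v : Fin b → PolyRing K n}
    (hv : v ∈ vectorsOfDegreeLE K n b (j - D).toNat) : degreeFilter a (Set.Iic j) v = v := by
  refine degreeFilter_eq_self_of_support fun k e he => ?_
  have h1 := (le_totalDegree (mem_support_iff.mpr he)).trans (mem_vectorsOfDegreeLE.mp hv k)
  have h2 : (e.sum fun _ i => i) = e.degree := rfl
  rw [ha, Set.mem_Iic]
  omega

namespace MinimalFreeResolution

variable {M : FGGradedModule K n} (F : MinimalFreeResolution M)

lemma single_notMem_range_diff (i : ℕ) (k : Fin (F.rank i)) :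
    Pi.single k 1 ∉ LinearMap.range (F.diff i) := by
  rintro ⟨v, hv⟩
  have h1 := F.minimal i v k
  rw [hv, Pi.single_eq_same, mem_span_X_iff_coeff_zero] at h1
  simp at h1

/-- The strand of degree `≤ j` of a resolution by modules `S(-Dᵢ)^{bᵢ}` is exact. -/
lemma inf_ker_diff_eq {i : ℕ} {D₁ D₂ j : ℤ} (h₁ : ∀ k, F.deg (i + 1) k = D₁)
    (h₂ : ∀ k, F.deg (i + 2) k = D₂) (hj₁ : D₁ ≤ j) (hj₂ : D₂ ≤ j) :
    vectorsOfDegreeLE K n (F.rank (i + 1)) (j - D₁).toNat ⊓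
        LinearMap.ker ((F.diff i).restrictScalars K) =
      (vectorsOfDegreeLE K n (F.rank (i + 2)) (j - D₂).toNat).map
        ((F.diff (i + 1)).restrictScalars K) := by
  ext v
  constructor
  · rintro ⟨hv, hk⟩
    obtain ⟨w, hw⟩ : v ∈ LinearMap.range (F.diff (i + 1)) := by
      rw [F.exact_succ]; exact hk
    -- Truncating the preimage w does not change its image v, as the differential is homogeneous and
    -- v already has degrees ≤ j.
    refine ⟨degreeFilter (F.deg (i + 2)) (Set.Iic j) w, degreeFilter_Iic_mem h₂ w, ?_⟩
    rw [LinearMap.restrictScalars_apply, map_degreeFilter _ (F.diff_homogeneous (i + 1)), hw]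
    exact degreeFilter_Iic_eq_self h₁ hj₁ hv
  · rintro ⟨w, hw, rfl⟩
    refine ⟨?_, ?_⟩
    · rw [SetLike.mem_coe] at hw
      rw [← degreeFilter_Iic_eq_self h₂ hj₂ hw, LinearMap.restrictScalars_apply,
        map_degreeFilter _ (F.diff_homogeneous (i + 1))]
      exact degreeFilter_Iic_mem h₁ _
    · have : F.diff (i + 1) w ∈ LinearMap.ker (F.diff i) := by
        rw [← F.exact_succ]; exact ⟨w, rfl⟩
      exact this

lemma inf_ker_aug_eq {D₁ D₂ j : ℤ} (h₁ : ∀ k, F.deg 0 k = D₁)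
    (h₂ : ∀ k, F.deg 1 k = D₂) (hj₁ : D₁ ≤ j) (hj₂ : D₂ ≤ j) :
    vectorsOfDegreeLE K n (F.rank 0) (j - D₁).toNat ⊓
        LinearMap.ker (F.aug.restrictScalars K) =
      (vectorsOfDegreeLE K n (F.rank 1) (j - D₂).toNat).map
        ((F.diff 0).restrictScalars K) := by
  ext v
  constructor
  · rintro ⟨hv, hk⟩
    obtain ⟨w, hw⟩ : v ∈ LinearMap.range (F.diff 0) := by
      rw [F.exact_zero]; exact hk
    refine ⟨degreeFilter (F.deg 1) (Set.Iic j) w, degreeFilter_Iic_mem h₂ w, ?_⟩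
    rw [LinearMap.restrictScalars_apply, map_degreeFilter _ (F.diff_homogeneous 0), hw]
    exact degreeFilter_Iic_eq_self h₁ hj₁ hv
  · rintro ⟨w, hw, rfl⟩
    refine ⟨?_, ?_⟩
    · rw [SetLike.mem_coe] at hw
      rw [← degreeFilter_Iic_eq_self h₂ hj₂ hw, LinearMap.restrictScalars_apply,
        map_degreeFilter _ (F.diff_homogeneous 0)]
      exact degreeFilter_Iic_mem h₁ _
    · have : F.diff 0 w ∈ LinearMap.ker F.aug := by
        rw [← F.exact_zero]; exact ⟨w, rfl⟩
      exact this

/-- The dimension of the degree `≤ j` part of `M`, for a resolution by modules `S(-Dᵢ)^{bᵢ}`. -/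
lemma finrank_map_aug {r : ℕ} {D : ℕ → ℤ} (hD : ∀ i k, F.deg i k = D i)
    (hr : ∀ i, r < i → F.rank i = 0) {j : ℤ} (hj : ∀ i, D i ≤ j) :
    (Module.finrank K ((vectorsOfDegreeLE K n (F.rank 0) (j - D 0).toNat).map
        (F.aug.restrictScalars K)) : ℚ) =
      ∑ i ∈ Finset.range (r + 1),
        (-1) ^ i * (F.rank i : ℚ) * ((((j - D i).toNat + n).choose n : ℕ) : ℚ) := by
  set z : ℕ → ℕ := fun i => Module.finrank K
    ((vectorsOfDegreeLE K n (F.rank (i + 1)) (j - D (i + 1)).toNat).map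
      ((F.diff i).restrictScalars K)) with hz
  have h0 := finrank_map_add_finrank_inf_ker (F.aug.restrictScalars K)
    (vectorsOfDegreeLE K n (F.rank 0) (j - D 0).toNat)
  rw [F.inf_ker_aug_eq (hD 0) (hD 1) (hj 0) (hj 1), finrank_vectorsOfDegreeLE] at h0
  have hs : ∀ i, z i + z (i + 1) =
      F.rank (i + 1) * ((j - D (i + 1)).toNat + n).choose n := by
    intro i
    have h1 := finrank_map_add_finrank_inf_ker ((F.diff i).restrictScalars K)
      (vectorsOfDegreeLE K n (F.rank (i + 1)) (j - D (i + 1)).toNat)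
    rwa [F.inf_ker_diff_eq (hD (i + 1)) (hD (i + 2)) (hj _) (hj _),
      finrank_vectorsOfDegreeLE] at h1
  have hzr : z r = 0 := by
    have := hs r
    rw [hr (r + 1) (Nat.lt_succ_self r), zero_mul] at this
    omega
  -- Rank–nullity telescopes: the partial sum up to m is off by (-1)^m z m, where z m is the
  -- dimension of the truncated image of F_{m+1} in F_m. This error vanishes at m = r.
  have hind : ∀ m : ℕ, (Module.finrank K ((vectorsOfDegreeLE K n (F.rank 0)
      (j - D 0).toNat).map (F.aug.restrictScalars K)) : ℚ) =
      ∑ i ∈ Finset.range (m + 1),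
        (-1) ^ i * (F.rank i : ℚ) * ((((j - D i).toNat + n).choose n : ℕ) : ℚ) -
        (-1) ^ m * z m := by
    intro m
    induction m with
    | zero =>
      have : ((_ + _ : ℕ) : ℚ) = _ := congrArg (Nat.cast (R := ℚ)) h0
      push_cast at this
      simp only [zero_add, Finset.sum_range_one, pow_zero, one_mul, hz]
      linarith
    | succ m ih =>
      have : ((_ + _ : ℕ) : ℚ) = _ := congrArg (Nat.cast (R := ℚ)) (hs m)
      push_cast at this
      rw [Finset.sum_range_succ, ih, pow_succ]
      linear_combination (-1) ^ m * (-1) * this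
  rw [hind r, hzr]
  simp

/-- If all generators of `F_i` have degree `D i`, the degrees increase up to the length. -/
lemma rank_ne_zero_and_deg_lt {D : ℕ → ℤ} (hD : ∀ i k, F.deg i k = D i) {j : ℕ}
    (hj : F.rank j ≠ 0) : ∀ i < j, F.rank i ≠ 0 ∧ D i < D j := by
  have step : ∀ i, F.rank (i + 1) ≠ 0 → F.rank i ≠ 0 ∧ D i < D (i + 1) := by
    intro i hi
    set k : Fin (F.rank (i + 1)) := ⟨0, Nat.pos_of_ne_zero hi⟩
    -- A generator in the kernel would be a boundary, against minimality. A nonzero coordinate of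
    -- its image has no constant term, so it has positive degree D (i + 1) - D i.
    have h1 : F.diff i (Pi.single k 1) ≠ 0 := by
      intro h
      refine F.single_notMem_range_diff (i + 1) k ?_
      rw [F.exact_succ]; exact h
    obtain ⟨l, hl⟩ := Function.ne_iff.mp h1
    obtain ⟨e, he⟩ := MvPolynomial.ne_zero_iff.mp hl
    have h2 := F.diff_homogeneous i k l e he
    have h3 := mem_span_X_iff_coeff_zero.mp (F.minimal i (Pi.single k 1) l)
    have h4 : e.degree ≠ 0 := by
      intro h
      rw [(Finsupp.degree_eq_zero_iff e).mp h] at he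
      exact he h3
    rw [hD, hD] at h2
    exact ⟨fun h => by have := l.2; omega, by omega⟩
  induction j with
  | zero => intro i hi; omega
  | succ j ih =>
    intro i hi
    obtain ⟨h1, h2⟩ := step j hj
    rcases Nat.lt_succ_iff_lt_or_eq.mp hi with h | rfl
    · exact ⟨(ih h1 i h).1, (ih h1 i h).2.trans h2⟩
    · exact ⟨h1, h2⟩

lemma rank_zero_ne_zero [Nontrivial M.carrier] : F.rank 0 ≠ 0 := by
  intro h
  obtain ⟨x, hx⟩ := exists_ne (0 : M.carrier)
  obtain ⟨v, rfl⟩ := F.aug_surjective x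
  have : v = 0 := by
    funext k
    exact absurd k.2 (by omega)
  exact hx (by rw [this, map_zero])

end MinimalFreeResolution

end Strand

/-! ### Pure modules, their Herzog–Kühl equations, and extremality. -/

section Pure

variable {K : Type u} [Field K] {n r : ℕ}

/-- A table vanishes outside the positions `(i, d_i)`. -/
def SupportedOn (d : Fin (r + 1) → ℤ) (x : ℕ → ℤ → ℚ) : Prop :=
  ∀ i j, x i j ≠ 0 → ∃ k : Fin (r + 1), (k : ℕ) = i ∧ d k = j

lemma IsPureOfType.supportedOn {M : FGGradedModule K n} {d : Fin (r + 1) → ℤ}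
    (hM : IsPureOfType M d) : SupportedOn d (bettiTable M) := by
  intro i j h
  have h' : bettiNumber M i j ≠ 0 := Nat.cast_ne_zero.mp h
  have hi : i < r + 1 := by
    by_contra hi
    exact h' (hM.length_le i j (by omega))
  refine ⟨⟨i, hi⟩, rfl, ?_⟩
  by_contra hj
  exact h' (hM.pure ⟨i, hi⟩ j (Ne.symm hj))

/-- The degrees `d`, continued by a constant. -/
def extendDegrees (d : Fin (r + 1) → ℤ) (i : ℕ) : ℤ :=
  d ⟨min i r, by omega⟩

lemma extendDegrees_coe (d : Fin (r + 1) → ℤ) (i : Fin (r + 1)) :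
    extendDegrees d i = d i := by
  unfold extendDegrees
  congr 1
  ext
  exact min_eq_left (by omega)

/-- A resolution of a module whose Betti table is supported on the positions `(i, d_i)`. -/
lemma exists_pure_resolution {M : FGGradedModule K n} {d : Fin (r + 1) → ℤ}
    (hM : SupportedOn d (bettiTable M)) :
    ∃ F : MinimalFreeResolution M, (∀ i k, F.deg i k = extendDegrees d i) ∧
      (∀ i, r < i → F.rank i = 0) ∧
      ∀ i : Fin (r + 1), bettiTable M i (d i) = F.rank i := by
  classical
  have hne := nonempty_minimalFreeResolution M
  -- This is the very resolution from which `bettiNumber` is read, so no uniqueness of resolutions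
  -- is needed.
  set F := hne.some with hF
  have hbetti : ∀ i j, bettiNumber M i j = F.betti i j := fun i j => by
    rw [bettiNumber, dif_pos hne]
  have hpos : ∀ i k, bettiTable M i (F.deg i k) ≠ 0 := by
    intro i k
    have : 0 < F.betti i (F.deg i k) := Fintype.card_pos_iff.mpr ⟨⟨k, rfl⟩⟩
    rw [bettiTable, hbetti]
    exact_mod_cast this.ne'
  have hdeg : ∀ i k, F.deg i k = extendDegrees d i := by
    intro i k
    obtain ⟨l, rfl, h⟩ := hM i _ (hpos i k)
    rw [extendDegrees_coe, h]
  refine ⟨F, hdeg, fun i hi => ?_, fun i => ?_⟩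
  · by_contra h0
    obtain ⟨l, hl, -⟩ := hM i _ (hpos i ⟨0, Nat.pos_of_ne_zero h0⟩)
    have := l.2
    omega
  · rw [bettiTable, hbetti, MinimalFreeResolution.betti]
    congr 1
    rw [Fintype.card_of_subtype (Finset.univ : Finset (Fin (F.rank i)))]
    · simp
    · intro k
      simp [hdeg, extendDegrees_coe]

/-- The Hilbert function of the degree `≤ j` part, computed from a pure Betti table. -/
def hilbertSum (n : ℕ) (d : Fin (r + 1) → ℤ) (j : ℤ) (x : ℕ → ℤ → ℚ) : ℚ :=
  ∑ i : Fin (r + 1), (-1) ^ (i : ℕ) * x i (d i) * ((((j - d i).toNat + n).choose n : ℕ) : ℚ)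

lemma hilbertSum_add (d : Fin (r + 1) → ℤ) (j : ℤ) (x y : ℕ → ℤ → ℚ) :
    hilbertSum n d j (x + y) = hilbertSum n d j x + hilbertSum n d j y := by
  simp only [hilbertSum, Pi.add_apply, ← Finset.sum_add_distrib]
  exact Finset.sum_congr rfl fun i _ => by ring

lemma hilbertSum_smul (d : Fin (r + 1) → ℤ) (j : ℤ) (a : ℚ) (x : ℕ → ℤ → ℚ) :
    hilbertSum n d j (a • x) = a * hilbertSum n d j x := by
  simp only [hilbertSum, Pi.smul_apply, smul_eq_mul, Finset.mul_sum]
  exact Finset.sum_congr rfl fun i _ => by ring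

lemma hilbertSum_bettiTable {M : FGGradedModule K n} {d : Fin (r + 1) → ℤ}
    {F : MinimalFreeResolution M} (hdeg : ∀ i k, F.deg i k = extendDegrees d i)
    (hrank : ∀ i, r < i → F.rank i = 0)
    (hbetti : ∀ i : Fin (r + 1), bettiTable M i (d i) = F.rank i) {j : ℤ} (hj : ∀ i, d i ≤ j) :
    hilbertSum n d j (bettiTable M) = Module.finrank K ((vectorsOfDegreeLE K n (F.rank 0)
      (j - extendDegrees d 0).toNat).map (F.aug.restrictScalars K)) := by
  rw [F.finrank_map_aug hdeg hrank (fun i => hj _), Finset.sum_range]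
  exact Finset.sum_congr rfl fun i _ => by rw [hbetti, extendDegrees_coe]

/-- The sum is a dimension. Only the support of the table matters, so this applies to every module
occurring in a decomposition of a pure table. -/
lemma hilbertSum_bettiTable_nonneg {M : FGGradedModule K n} {d : Fin (r + 1) → ℤ}
    (hM : SupportedOn d (bettiTable M)) {j : ℤ} (hj : ∀ i, d i ≤ j) :
    0 ≤ hilbertSum n d j (bettiTable M) := by
  obtain ⟨F, hdeg, hrank, hbetti⟩ := exists_pure_resolution hM
  rw [hilbertSum_bettiTable hdeg hrank hbetti hj]
  positivity

/-- The Hilbert function of a pure module of codimension `r` grows at most like a polynomial of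
degree `n - r`. -/
lemma IsPureOfType.exists_hilbertSum_le {M : FGGradedModule K n} {d : Fin (r + 1) → ℤ}
    (hM : IsPureOfType M d) :
    r ≤ n ∧ ∃ U : Polynomial ℚ, U.natDegree ≤ n - r ∧ ∀ j : ℕ, (∀ i, d i ≤ j) →
      hilbertSum n d j (bettiTable M) ≤ U.eval (j : ℚ) := by
  classical
  obtain ⟨F, hdeg, hrank, hbetti⟩ := exists_pure_resolution hM.supportedOn
  obtain ⟨hr, U, hU, hbound⟩ := exists_polynomial_bound hM.dim_add
    (fun k => F.aug (Pi.single k 1))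
  -- The shift by d_0 appears because elements of F_0 of degree at most j have coefficients of
  -- degree at most j - d_0.
  refine ⟨hr, U.comp (Polynomial.X - Polynomial.C (extendDegrees d 0 : ℚ)), ?_, fun j hj => ?_⟩
  · refine Polynomial.natDegree_comp_le.trans ?_
    rw [Polynomial.natDegree_X_sub_C, mul_one]
    exact hU
  · rw [hilbertSum_bettiTable hdeg hrank hbetti hj]
    have h1 : (j : ℚ) - (extendDegrees d 0 : ℚ) = (((j : ℤ) - extendDegrees d 0).toNat : ℚ) := by
      have h2 : ((((j : ℤ) - extendDegrees d 0).toNat : ℤ) : ℚ) =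
          (((j : ℤ) - extendDegrees d 0 : ℤ) : ℚ) := by
        rw [Int.toNat_of_nonneg (sub_nonneg.mpr (hj _) : 0 ≤ (j : ℤ) - extendDegrees d 0)]
      push_cast at h2
      exact h2.symm
    rw [Polynomial.eval_comp, Polynomial.eval_sub, Polynomial.eval_X, Polynomial.eval_C, h1]
    refine hbound _ _ ?_
    rintro _ ⟨v, hv, rfl⟩
    refine ⟨v, mem_vectorsOfDegreeLE.mp hv, ?_⟩
    rw [LinearMap.restrictScalars_apply]
    conv_lhs => rw [← Finset.univ_sum_single v, map_sum]
    refine Finset.sum_congr rfl fun k _ => ?_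
    rw [← map_smul, ← Pi.single_smul, smul_eq_mul, mul_one]

/-- The Herzog–Kühl equations hold for every table whose Hilbert function is nonnegative and
bounded by a multiple of that of a pure module of type `d`. -/
lemma IsPureOfType.herzogKuhl_of_le {M : FGGradedModule K n} {d : Fin (r + 1) → ℤ}
    (hM : IsPureOfType M d) {x : ℕ → ℤ → ℚ} {t : ℚ} (ht : 0 ≤ t)
    (hx : ∀ j : ℕ, (∀ i, d i ≤ j) → 0 ≤ hilbertSum n d j x ∧
      hilbertSum n d j x ≤ t * hilbertSum n d j (bettiTable M)) :
    ∀ s < r, ∑ i : Fin (r + 1), (-1 : ℚ) ^ (i : ℕ) * x i (d i) * (d i : ℚ) ^ s = 0 := by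
  obtain ⟨hr, U, hU, hbound⟩ := hM.exists_hilbertSum_le
  refine sum_mul_pow_eq_zero_of_growth (fun i : Fin (r + 1) => (-1 : ℚ) ^ (i : ℕ) * x i (d i)) d hr
    (Polynomial.C t * U) ((Polynomial.natDegree_C_mul_le _ _).trans hU) ?_
  have hlarge : ∀ᶠ j : ℕ in Filter.atTop, ∀ i, d i ≤ j := by
    rw [Filter.eventually_all]
    intro i
    filter_upwards [Filter.eventually_ge_atTop (d i).toNat] with j hj
    omega
  filter_upwards [hlarge] with j hj
  obtain ⟨h1, h2⟩ := hx j hj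
  rw [Polynomial.eval_mul, Polynomial.eval_C]
  exact (abs_of_nonneg h1).trans_le (h2.trans (mul_le_mul_of_nonneg_left (hbound j hj) ht))

lemma IsPureOfType.herzogKuhl {M : FGGradedModule K n} {d : Fin (r + 1) → ℤ}
    (hM : IsPureOfType M d) :
    ∀ s < r, ∑ i : Fin (r + 1), (-1 : ℚ) ^ (i : ℕ) * bettiTable M i (d i) * (d i : ℚ) ^ s = 0 :=
  hM.herzogKuhl_of_le zero_le_one fun _ hj =>
    ⟨hilbertSum_bettiTable_nonneg hM.supportedOn hj, (one_mul _).ge⟩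

lemma IsPureOfType.nontrivial {M : FGGradedModule K n} {d : Fin (r + 1) → ℤ}
    (hM : IsPureOfType M d) : Nontrivial M.carrier := by
  rw [← Module.supportDim_ne_bot_iff_nontrivial (R := PolyRing K n)]
  intro h
  have := hM.dim_add
  rw [h, WithBot.bot_add] at this
  exact absurd this (by exact WithBot.bot_ne_coe)

/-- The type of a pure module is strictly increasing and all its Betti numbers `β_{i,d_i}` are
positive. -/
lemma IsPureOfType.strictMono_and_pos {M : FGGradedModule K n} {d : Fin (r + 1) → ℤ}
    (hM : IsPureOfType M d) : StrictMono d ∧ ∀ i : Fin (r + 1), 0 < bettiTable M i (d i) := by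
  classical
  obtain ⟨F, hdeg, hrank, hbetti⟩ := exists_pure_resolution hM.supportedOn
  have := hM.nontrivial
  have hchain := @MinimalFreeResolution.rank_ne_zero_and_deg_lt _ _ _ _ F _ hdeg
  have hall : ∀ i : Fin (r + 1), F.rank i ≠ 0 := by
    by_contra! h
    obtain ⟨l, hl⟩ := h
    -- If F_l = 0, at most r - 1 positive indices carry a nonzero term. The polynomial with these
    -- roots leaves only β_0 times a nonzero value, as d_0 < d_j for j in s.
    set s : Finset (Fin (r + 1)) := Finset.univ.filter fun j => j ≠ 0 ∧ F.rank j ≠ 0 with hs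
    have hl0 : l ≠ 0 := by
      rintro rfl
      exact F.rank_zero_ne_zero hl
    have hcard : s.card < r := by
      have h1 : s ⊆ (Finset.univ.erase 0).erase l := by
        intro j hj
        rw [hs, Finset.mem_filter] at hj
        refine Finset.mem_erase.mpr ⟨?_, Finset.mem_erase.mpr ⟨hj.2.1, Finset.mem_univ _⟩⟩
        rintro rfl
        exact hj.2.2 hl
      have h2 := Finset.card_le_card h1
      rw [Finset.card_erase_of_mem (by simp [hl0]), Finset.card_erase_of_mem (Finset.mem_univ _),
        Finset.card_univ, Fintype.card_fin] at h2
      have h3 : (l : ℕ) ≠ 0 := fun h => hl0 (Fin.ext h)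
      have := l.2
      omega
    have h1 := sum_mul_eval_eq_zero hM.herzogKuhl
      (p := ∏ j ∈ s, ((Polynomial.X : Polynomial ℚ) - Polynomial.C (d j : ℚ)))
      (by rw [natDegree_prod_X_sub_C_eq_card s fun j => (d j : ℚ)]; exact hcard)
    simp only [Polynomial.eval_prod, Polynomial.eval_sub, Polynomial.eval_X,
      Polynomial.eval_C] at h1
    rw [Finset.sum_eq_single 0 (fun i _ hi => ?_) (fun h => absurd (Finset.mem_univ _) h)] at h1
    · have h2 : ∏ j ∈ s, ((d 0 : ℚ) - d j) ≠ 0 := by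
        rw [Finset.prod_ne_zero_iff]
        intro j hj
        rw [hs, Finset.mem_filter] at hj
        have h3 := (hchain hj.2.2 0 (Nat.pos_of_ne_zero fun h => hj.2.1 (Fin.ext h))).2
        rw [extendDegrees_coe, show extendDegrees d 0 = d 0 from extendDegrees_coe d 0] at h3
        rw [sub_ne_zero]
        exact_mod_cast h3.ne
      have h4 : bettiTable M (0 : Fin (r + 1)) (d 0) ≠ 0 := by
        rw [hbetti]
        exact_mod_cast F.rank_zero_ne_zero
      simp only [mul_eq_zero, h2, h4, or_false] at h1
      exact pow_ne_zero _ (by norm_num) h1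
    · by_cases h0 : F.rank i = 0
      · rw [hbetti, h0]; simp
      · rw [Finset.prod_eq_zero (i := i), mul_zero]
        · rw [hs]; simp [hi, h0]
        · simp
  refine ⟨fun i j hij => ?_, fun i => ?_⟩
  · have := (hchain (hall j) i hij).2
    rwa [extendDegrees_coe, extendDegrees_coe] at this
  · rw [hbetti]
    exact_mod_cast Nat.pos_of_ne_zero (hall i)

/-- The solutions of the Herzog–Kühl equations with nonnegative entries. -/
lemma eq_mul_prod_of_herzogKuhl {d : Fin (r + 1) → ℤ} (hd : Function.Injective d)
    {b : Fin (r + 1) → ℚ} (hb : ∀ i, 0 ≤ b i)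
    (h : ∀ s < r, ∑ i : Fin (r + 1), (-1 : ℚ) ^ (i : ℕ) * b i * (d i : ℚ) ^ s = 0)
    (i : Fin (r + 1)) :
    b i = (b 0 * ∏ j ∈ Finset.univ.erase 0, |(d j : ℚ) - d 0|) *
      ∏ j ∈ Finset.univ.erase i, 1 / |(d j : ℚ) - d i| := by
  -- Absolute values absorb (-1)^i and the signs of the differences; nonnegativity of b lets b i
  -- come out unchanged.
  have habs : ∀ i : Fin (r + 1), |(-1 : ℚ) ^ (i : ℕ) * b i *
      ∏ j ∈ Finset.univ.erase i, ((d i : ℚ) - d j)| =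
      b i * ∏ j ∈ Finset.univ.erase i, |(d j : ℚ) - d i| := by
    intro i
    rw [abs_mul, abs_mul, abs_pow, abs_neg, abs_one, one_pow, one_mul, abs_of_nonneg (hb i),
      Finset.abs_prod]
    simp_rw [abs_sub_comm]
  have h1 := congrArg abs (mul_prod_sub_eq_of_sum_mul_pow_eq_zero h i 0)
  rw [habs, habs] at h1
  have h2 : ∏ j ∈ Finset.univ.erase i, |(d j : ℚ) - d i| ≠ 0 := by
    rw [Finset.prod_ne_zero_iff]
    intro j hj
    rw [abs_ne_zero, sub_ne_zero]
    exact fun h => (Finset.mem_erase.mp hj).1 (hd (by exact_mod_cast h))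
  rw [← h1, mul_assoc, ← Finset.prod_mul_distrib]
  rw [Finset.prod_eq_one, mul_one]
  intro j hj
  have h3 := (Finset.prod_ne_zero_iff.mp h2) j hj
  field_simp

/-- A nonnegative table supported on the positions `(i, d_i)` that satisfies the Herzog–Kühl
equations is a multiple of the Betti table of any pure module of type `d`. -/
lemma IsPureOfType.eq_smul_of_herzogKuhl {M : FGGradedModule K n} {d : Fin (r + 1) → ℤ}
    (hM : IsPureOfType M d) {x : ℕ → ℤ → ℚ} (hsupp : SupportedOn d x) (hx : ∀ i j, 0 ≤ x i j)
    (h : ∀ s < r, ∑ i : Fin (r + 1), (-1 : ℚ) ^ (i : ℕ) * x i (d i) * (d i : ℚ) ^ s = 0) :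
    x = (x 0 (d 0) / bettiTable M 0 (d 0)) • bettiTable M := by
  obtain ⟨hmono, hpos⟩ := hM.strictMono_and_pos
  funext i j
  rw [Pi.smul_apply, Pi.smul_apply, smul_eq_mul]
  by_cases hij : ∃ k : Fin (r + 1), (k : ℕ) = i ∧ d k = j
  · obtain ⟨k, rfl, rfl⟩ := hij
    have h1 := eq_mul_prod_of_herzogKuhl hmono.injective (fun i => hx i (d i)) h k
    have h2 := eq_mul_prod_of_herzogKuhl hmono.injective (fun i => (hpos i).le) hM.herzogKuhl k
    have h3 : bettiTable M 0 (d 0) ≠ 0 := (hpos 0).ne'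
    simp only [Fin.val_zero] at h1 h2
    rw [h1, h2]
    field_simp
  · have h1 : x i j = 0 := by
      by_contra h0; exact hij (hsupp i j h0)
    have h2 : bettiTable M i j = 0 := by
      by_contra h0; exact hij (hM.supportedOn i j h0)
    rw [h1, h2, mul_zero]

lemma nonneg_of_mem_boijSoderbergCone {x : ℕ → ℤ → ℚ} (hx : x ∈ boijSoderbergCone K n) :
    ∀ i j, 0 ≤ x i j := by
  refine Submodule.span_induction ?_ ?_ ?_ ?_ hx
  · rintro _ ⟨M, rfl⟩ i j
    exact Nat.cast_nonneg _
  · intro i j; exact le_rfl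
  · intro x y _ _ hx hy i j
    exact add_nonneg (hx i j) (hy i j)
  · intro a x _ hx i j
    exact mul_nonneg a.2 (hx i j)

/-- Nonnegative entries cannot cancel. -/
lemma SupportedOn.of_add {d : Fin (r + 1) → ℤ} {x y : ℕ → ℤ → ℚ} (h : SupportedOn d (x + y))
    (hx : ∀ i j, 0 ≤ x i j) (hy : ∀ i j, 0 ≤ y i j) : SupportedOn d x ∧ SupportedOn d y := by
  constructor
  · intro i j h0
    exact h i j (add_pos_of_pos_of_nonneg ((hx i j).lt_of_ne' h0) (hy i j)).ne'
  · intro i j h0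
    exact h i j (add_pos_of_nonneg_of_pos (hx i j) ((hy i j).lt_of_ne' h0)).ne'

lemma hilbertSum_nonneg_of_mem_boijSoderbergCone {d : Fin (r + 1) → ℤ} {x : ℕ → ℤ → ℚ}
    (hx : x ∈ boijSoderbergCone K n) (hsupp : SupportedOn d x) {j : ℤ} (hj : ∀ i, d i ≤ j) :
    0 ≤ hilbertSum n d j x := by
  refine Submodule.span_induction (p := fun x _ => SupportedOn d x → 0 ≤ hilbertSum n d j x)
    ?_ ?_ ?_ ?_ hx hsupp
  · rintro _ ⟨M, rfl⟩ h
    exact hilbertSum_bettiTable_nonneg h hj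
  · intro _
    simp [hilbertSum]
  · intro x y hx hy ihx ihy h
    obtain ⟨h1, h2⟩ := h.of_add (nonneg_of_mem_boijSoderbergCone hx)
      (nonneg_of_mem_boijSoderbergCone hy)
    rw [hilbertSum_add]
    exact add_nonneg (ihx h1) (ihy h2)
  · intro a x _ ih h
    -- For a = 0 the support of a • x says nothing about that of x.
    rcases eq_or_ne a 0 with rfl | ha
    · rw [zero_smul]; simp [hilbertSum]
    · have ha' : (a : ℚ) ≠ 0 := fun h => ha (Subtype.ext h)
      have h1 : SupportedOn d x := fun i k h0 => h i k (mul_ne_zero ha' h0)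
      have h2 : hilbertSum n d j (a • x) = (a : ℚ) * hilbertSum n d j x := hilbertSum_smul d j _ x
      rw [h2]
      exact mul_nonneg a.2 (ih h1)

lemma mem_hull_singleton_iff {V : Type*} [AddCommGroup V] [Module ℚ V] {x v : V} :
    x ∈ PointedCone.hull ℚ {v} ↔ ∃ t : ℚ, 0 ≤ t ∧ x = t • v := by
  constructor
  · intro h
    obtain ⟨a, ha⟩ := Submodule.mem_span_singleton.mp h
    exact ⟨a, a.2, ha.symm⟩
  · rintro ⟨t, ht, rfl⟩
    exact Submodule.mem_span_singleton.mpr ⟨⟨t, ht⟩, rfl⟩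

lemma IsPureOfType.isFaceOf {M : FGGradedModule K n} {d : Fin (r + 1) → ℤ}
    (hM : IsPureOfType M d) :
    (PointedCone.hull ℚ {bettiTable M}).IsFaceOf (boijSoderbergCone K n) := by
  -- The face condition concerns only x in a • x + y with a > 0; a = 1 and symmetry give both
  -- summands.
  refine ⟨?_, fun {x y a} hx hy ha hxy => ?_⟩
  · refine Submodule.span_le.mpr ?_
    rintro _ rfl
    exact Submodule.subset_span ⟨M, rfl⟩
  · obtain ⟨t, ht, hxy⟩ := mem_hull_singleton_iff.mp hxy
    have hx0 := nonneg_of_mem_boijSoderbergCone hx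
    have hy0 := nonneg_of_mem_boijSoderbergCone hy
    have hsupp : SupportedOn d (a • x + y) := by
      rw [hxy]
      intro i j h0
      exact hM.supportedOn i j (right_ne_zero_of_mul h0)
    obtain ⟨h1, hysupp⟩ := hsupp.of_add (fun i j => mul_nonneg ha.le (hx0 i j)) hy0
    have hxsupp : SupportedOn d x := fun i j h0 => h1 i j (mul_ne_zero ha.ne' h0)
    -- The Hilbert sum of y is nonnegative, so a times that of x is at most t times that of M.
    have hHK := hM.herzogKuhl_of_le (x := x) (t := t / a) (by positivity) fun j hj => by
      refine ⟨hilbertSum_nonneg_of_mem_boijSoderbergCone hx hxsupp hj, ?_⟩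
      have h2 := hilbertSum_nonneg_of_mem_boijSoderbergCone hy hysupp hj
      have h3 := congrArg (hilbertSum n d (j : ℤ)) hxy
      rw [hilbertSum_add, hilbertSum_smul, hilbertSum_smul] at h3
      rw [div_mul_eq_mul_div, le_div_iff₀ ha]
      linarith
    exact mem_hull_singleton_iff.mpr ⟨_, div_nonneg (hx0 _ _) (Nat.cast_nonneg _),
      hM.eq_smul_of_herzogKuhl hxsupp hx0 hHK⟩

end Pure

end BoijSoderberg

end

theorem proposition2p1 {K : Type*} [Field K] {n r : ℕ} (d : Fin (r + 1) → ℤ)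
    (M : BoijSoderberg.FGGradedModule K n) (hM : BoijSoderberg.IsPureOfType M d) :
    -- the type is strictly increasing, and the Herzog–Kühl equations hold
    StrictMono d ∧
    (∀ s < r, ∑ i : Fin (r + 1),
      (-1 : ℚ) ^ (i : ℕ) * BoijSoderberg.bettiTable M i (d i) * (d i : ℚ) ^ s = 0) ∧
    -- the Betti table is determined by `d` up to a positive rational factor
    (∃ q : ℚ, 0 < q ∧ ∀ i : Fin (r + 1), BoijSoderberg.bettiTable M i (d i) =
      q * ∏ j ∈ Finset.univ.erase i, 1 / |(d j : ℚ) - (d i : ℚ)|) ∧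
    (∀ M' : BoijSoderberg.FGGradedModule K n, BoijSoderberg.IsPureOfType M' d →
      ∃ q : ℚ, 0 < q ∧ BoijSoderberg.bettiTable M' = q • BoijSoderberg.bettiTable M) ∧
    -- it spans an extremal ray of the Boij–Söderberg cone
    BoijSoderberg.SpansExtremalRay (BoijSoderberg.boijSoderbergCone K n)
      (BoijSoderberg.bettiTable M) := by
  obtain ⟨hmono, hpos⟩ := hM.strictMono_and_pos
  have hne : ∀ i j : Fin (r + 1), j ∈ Finset.univ.erase i → 0 < |(d j : ℚ) - d i| := by
    intro i j hj
    rw [abs_pos, sub_ne_zero]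
    exact fun h => (Finset.mem_erase.mp hj).1 (hmono.injective (by exact_mod_cast h))
  -- The factor is q = β_{0,d_0} ∏_{j ≠ 0} |d_j - d_0|.
  refine ⟨hmono, hM.herzogKuhl, ⟨_, mul_pos (hpos 0) (Finset.prod_pos (hne 0)),
    BoijSoderberg.eq_mul_prod_of_herzogKuhl hmono.injective (fun i => (hpos i).le)
      hM.herzogKuhl⟩, fun M' hM' => ?_, fun h => ?_, hM.isFaceOf⟩
  · exact ⟨_, div_pos (hM'.strictMono_and_pos.2 0) (hpos 0),
      hM.eq_smul_of_herzogKuhl hM'.supportedOn (fun _ _ => Nat.cast_nonneg _) hM'.herzogKuhl⟩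
  · have := hpos 0
    rw [h] at this
    exact lt_irrefl _ this
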